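/- Graphs are finite and may have multiple edges and loops. A signed graph $(G,\sigma)$ is a graph $G$ with a map $\sigma:E(G)\to\{+,-\}$; $E^-$ is its set of negative edges. For $X\subseteq V(G)$, $\partial_G(X)$ is the set of edges with one end in $X$ and the other in $V(G)\setminus X$; it is an $(a,b)$-cut if it has exactly $a$ positive and $b$ negative edges. Switching at $\partial_G(X)$ changes the signs of all edges in $\partial_G(X)$. The frustration index $l(G,\sigma)$ is the minimum number of negative edges over all signatures obtained from $\sigma$ by switching. $(G,\sigma)$ is critically $k$-frustrated if $l(G,\sigma)=k$ and $l(G\setminus e,\sigma)=k-1$ for every $e\in E(G)$. Subdividing a set of $t\ge 1$ parallel edges of the same sign $s$ between $x$ and $y$ means deleting it and adding a new vertex $w$ with $t$ positive edges between $x$ and $w$ and $t$ edges of sign $s$ between $w$ and $y$. $(G,\sigma)$ is irreducible if it does not arise from any signed graph by one or more such subdivisions. A cycle (a connected 2-regular subgraph) is negative if it has an odd number of negative edges. Let $\mathcal S^*(k)$ be the family of prime critically $k$-frustrated signed graphs, that is, of the critically $k$-frustrated signed graphs that are irreducible and contain no two edge-disjoint negative cycles. Let $k\ge 2$ and $(G,\sigma)\in\mathcal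 S^*(k)$. A canonical embedding of $(G,\sigma)$ is an embedding on the projective plane obtained as follows. The subgraph $G^+=G\setminus E^-$ is a 2-connected plane graph. One of its faces has a boundary circuit $C$ that contains $2k$ distinct vertices $z_1,\dots,z_{2k}$, in this cyclic order. The vertices $z_1,\dots,z_{2k}$ have degree 2 in $G^+$ and all other vertices have degree 3 in $G^+$ (so $G^+$ arises from a 2-connected plane cubic graph $G'$, which for $G^+=C$ is understood to be a circle without vertices, by inserting $z_1,\dots,z_{2k}$ on the edges of a facial circuit of $G'$). The graph $G$ has exactly $k$ negative edges, and they join $z_i$ to $z_{k+i}$ for $i=1,\dots,k$; they are drawn through a crosscap placed in the face bounded by $C$. **Claim.** Let $k\ge 2$, let $(G,\sigma)\in\mathcal S^*(k)$, and fix a canonical embedding of $(G,\sigma)$. Then every $(2,2)$-cut of $(G,\sigma)$ has the form $\partial_G(X)$ for some $X\subseteq V(G)$ such that either $G[X]\cong K_2$, or $G[X]$ is a 4-cycle that bounds a face of the embedding, this face being a face of $G^+$ other than the one that contains the crosscap. -/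

import Mathlib

open scoped Graph

namespace SignedGraph

universe u v

/-! ### Graphs with multiple edges and loops (Mathlib's `Graph`) -/

section Graphs

variable {α : Type u} {β : Type v}

/-- The graph has finitely many vertices and finitely many edges. -/
def IsFinite (G : Graph α β) : Prop := V(G).Finite ∧ E(G).Finite

/-- The degree of a vertex; a loop counts twice. -/
noncomputable def degree (G : Graph α β) (x : α) : ℕ :=
  (G.incidenceSet x).ncard + (G.loopSet x).ncard

/-- Nonempty, and any two vertices are joined by a walk. -/
def Connected (G : Graph α β) : Prop :=
  V(G).Nonempty ∧ ∀ x ∈ V(G), ∀ y ∈ V(G), Relation.ReflTransGen G.Adj x y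

/-- Loopless, connected, with more than two vertices and without a cut vertex. -/
def TwoConnected (G : Graph α β) : Prop :=
  G.Loopless ∧ 2 < V(G).ncard ∧ Connected G ∧ ∀ x ∈ V(G), Connected (G.deleteVerts {x})

/-- A cycle: a connected 2-regular graph. -/
def IsCycle (C : Graph α β) : Prop :=
  Connected C ∧ ∀ x ∈ V(C), degree C x = 2

/-- The graph is (a copy of) `K₂`: two vertices and one edge, which joins them. -/
def IsK2 (H : Graph α β) : Prop :=
  ∃ x y e, x ≠ y ∧ V(H) = {x, y} ∧ E(H) = {e} ∧ H.IsLink e x y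

/-- The edge cut `∂_G(X)`. -/
def cut (G : Graph α β) (X : Set α) : Set β :=
  {e | ∃ x y, G.IsLink e x y ∧ x ∈ X ∧ y ∈ V(G) \ X}

end Graphs

/-! ### Signed graphs

A signed graph is a pair `(G, σ)` with `σ : β → ℤˣ`; the edge `e` is positive if `σ e = 1` and
negative if `σ e = -1`. Only the values of `σ` on `E(G)` matter. -/

section Signed

variable {α : Type u} {β : Type v}

def posEdges (G : Graph α β) (σ : β → ℤˣ) : Set β := {e ∈ E(G) | σ e = 1}

def negEdges (G : Graph α β) (σ : β → ℤˣ) : Set β := {e ∈ E(G) | σ e = -1}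

/-- `∂_G(X)` is an `(a, b)`-cut: it has `a` positive and `b` negative edges. -/
def IsCutOfType (G : Graph α β) (σ : β → ℤˣ) (a b : ℕ) (X : Set α) : Prop :=
  (cut G X ∩ posEdges G σ).encard = a ∧ (cut G X ∩ negEdges G σ).encard = b

open Classical in
/-- Switching at `∂_G(X)`: the signs of the edges of the cut are changed. -/
noncomputable def switch (G : Graph α β) (X : Set α) (σ : β → ℤˣ) : β → ℤˣ :=
  fun e => if e ∈ cut G X then -σ e else σ e

/-- `π` is obtained from `σ` by switching at some edge cut. -/
def SwitchEquiv (G : Graph α β) (σ π : β → ℤˣ) : Prop :=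
  ∃ X ⊆ V(G), ∀ e ∈ E(G), π e = switch G X σ e

/-- The frustration index `l(G, σ)`: the least number of negative edges over all signatures that
are switching equivalent to `σ`. -/
noncomputable def frustrationIndex (G : Graph α β) (σ : β → ℤˣ) : ℕ :=
  sInf {n | ∃ π, SwitchEquiv G σ π ∧ (negEdges G π).ncard = n}

/-- `(G, σ)` is critically `k`-frustrated: `l(G, σ) = k`, and `l(G \ e, σ) = k - 1` for every
edge `e`. -/
def IsCritical (G : Graph α β) (σ : β → ℤˣ) (k : ℕ) : Prop :=
  frustrationIndex G σ = k ∧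
    ∀ e ∈ E(G), frustrationIndex (G.deleteEdges {e}) σ + 1 = k

/-- `C` is a negative cycle of `(G, σ)`. -/
def IsNegativeCycle (G : Graph α β) (σ : β → ℤˣ) (C : Graph α β) : Prop :=
  C ≤ G ∧ IsCycle C ∧ Odd (negEdges C σ).ncard

/-- `(G', σ')` arises from `(G, σ)` by subdividing one multiedge: a nonempty finite set `S` of
parallel edges of the same sign `s` between `x` and `y` is deleted, and a new vertex `w` is added
together with a set `A` of `|S|` positive edges between `x` and `w` and a set `B` of `|S|` edges
of sign `s` between `w` and `y`. -/
def SubdivisionStep (G : Graph α β) (σ : β → ℤˣ) (G' : Graph α β) (σ' : β → ℤˣ) : Prop :=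
  ∃ (x y w : α) (S A B : Set β) (s : ℤˣ),
    S.Nonempty ∧ S.Finite ∧ (∀ e ∈ S, G.IsLink e x y ∧ σ e = s) ∧
    w ∉ V(G) ∧ A.encard = S.encard ∧ B.encard = S.encard ∧
    Disjoint A B ∧ Disjoint (A ∪ B) (E(G) \ S) ∧
    V(G') = insert w V(G) ∧
    (∀ e a b, G'.IsLink e a b ↔
      (G.IsLink e a b ∧ e ∉ S) ∨ (e ∈ A ∧ s(a, b) = s(x, w)) ∨ (e ∈ B ∧ s(a, b) = s(w, y))) ∧
    (∀ e ∈ E(G) \ S, σ' e = σ e) ∧ (∀ e ∈ A, σ' e = 1) ∧ (∀ e ∈ B, σ' e = s)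

/-- `(G', σ')` is a proper subdivision of `(G, σ)`: it arises by subdividing at least once. (Each
subdivision adds a vertex, so this is the same as a subdivision different from `(G, σ)`.) -/
def IsProperSubdivision (G : Graph α β) (σ : β → ℤˣ) (G' : Graph α β) (σ' : β → ℤˣ) : Prop :=
  Relation.TransGen (fun p q : Graph α β × (β → ℤˣ) => SubdivisionStep p.1 p.2 q.1 q.2)
    (G, σ) (G', σ')

/-- `(G, σ)` is not a proper subdivision of any signed graph. Since a signed graph of which
`(G, σ)` is a proper subdivision has fewer vertices and edges than `(G, σ)`, it has a copy on the
same types. -/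
def Irreducible (G : Graph α β) (σ : β → ℤˣ) : Prop :=
  ∀ (H : Graph α β) (τ : β → ℤˣ), ¬ IsProperSubdivision H τ G σ

/-- `(G, σ)` is a prime critically `k`-frustrated signed graph, i.e. a member of `S*(k)`: it is
critically `k`-frustrated and irreducible, and it has no two edge-disjoint negative cycles. -/
def IsPrimeCritical (G : Graph α β) (σ : β → ℤˣ) (k : ℕ) : Prop :=
  IsCritical G σ k ∧ Irreducible G σ ∧
    ¬ ∃ C D : Graph α β, IsNegativeCycle G σ C ∧ IsNegativeCycle G σ D ∧ Disjoint E(C) E(D)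

/-- The all-positive subgraph `G⁺ = G \ E⁻`. -/
def posSubgraph (G : Graph α β) (σ : β → ℤˣ) : Graph α β := G.deleteEdges (negEdges G σ)

end Signed

/-! ### Plane graphs

A plane embedding of a connected loopless graph is given combinatorially, by the cyclic order of
the edges around each vertex (a rotation system), such that Euler's formula for the sphere
holds. -/

section Plane

variable {α : Type u} {β : Type v}

/-- An edge together with a direction, from `tail` to `head`. -/
@[ext]
structure Dart (G : Graph α β) where
  edge : β
  tail : α
  head : α
  isLink : G.IsLink edge tail head

namespace Dart

variable {G : Graph α β}

/-- The same edge in the opposite direction. -/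
def flip (d : Dart G) : Dart G := ⟨d.edge, d.head, d.tail, d.isLink.symm⟩

theorem flip_involutive : Function.Involutive (flip : Dart G → Dart G) := fun _ => rfl

/-- The reversal of darts as a permutation. -/
def rev : Equiv.Perm (Dart G) := flip_involutive.toPerm

end Dart

/-- A plane embedding of the graph `G`. -/
structure PlaneEmbedding (G : Graph α β) where
  loopless : G.Loopless
  connected : Connected G
  /-- the next dart around the tail of a dart -/
  next : Equiv.Perm (Dart G)
  tail_next : ∀ d, (next d).tail = d.tail
  sameCycle_of_tail_eq : ∀ d d' : Dart G, d.tail = d'.tail → next.SameCycle d d'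
  /-- Euler's formula `|V| - |E| + |F| = 2`; the faces are the orbits of the permutation that
  follows a dart to its head and continues with the next dart there -/
  euler : V(G).ncard + Nat.card (Quotient (Equiv.Perm.SameCycle.setoid (next * Dart.rev))) =
    E(G).ncard + 2

namespace PlaneEmbedding

variable {G : Graph α β} (M : PlaneEmbedding G)

/-- The successor of a dart along the boundary walk of the face at its side. The faces of the
plane graph are the cycles (orbits) of this permutation. -/
def face : Equiv.Perm (Dart G) := M.next * Dart.rev

/-- The length of the boundary walk of the face of `d`. -/
noncomputable def faceLength (d : Dart G) : ℕ := Function.minimalPeriod M.face d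

/-- The set of vertices on the boundary of the face of `d`. -/
def faceVerts (d : Dart G) : Set α := {x | ∃ d', M.face.SameCycle d d' ∧ d'.tail = x}

/-- The set of edges on the boundary of the face of `d`. -/
def faceEdges (d : Dart G) : Set β := {e | ∃ d', M.face.SameCycle d d' ∧ d'.edge = e}

end PlaneEmbedding

end Plane

/-! ### Canonical embeddings -/

section Canonical

variable {α : Type u} {β : Type v}

/-- A canonical embedding of `(G, σ)` on the projective plane, with `k` negative edges, all of them
drawn in a crosscap that is put into one face of a plane graph.

The subgraph `G⁺` of the positive edges is a 2-connected plane graph. Following the facial circuit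
`C` of one of its faces, the *outer* face, one meets `2 k` distinct vertices
`z 0, …, z (2 k - 1)` in this order. They are the vertices inserted on `C`: they have degree `2`
in `G⁺` and all the other vertices have degree `3`, so that suppressing the `z i` leaves a cubic
plane graph `G'`, of which `G⁺` is the subdivision. The negative edges are `k` edges that join
`z i` to the antipodal vertex `z (i + k)`, for `i < k`. -/
structure CanonicalEmbedding (G : Graph α β) (σ : β → ℤˣ) (k : ℕ) where
  twoConnected : TwoConnected (posSubgraph G σ)
  plane : PlaneEmbedding (posSubgraph G σ)
  /-- a dart on the boundary of the outer face -/
  outer : Dart (posSubgraph G σ)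
  z : Fin (2 * k) → α
  z_injective : Function.Injective z
  /-- the place of `z i` on the boundary walk of the outer face that starts with `outer` -/
  pos : Fin (2 * k) → ℕ
  pos_strictMono : StrictMono pos
  pos_lt : ∀ i, pos i < plane.faceLength outer
  tail_pos : ∀ i, ((plane.face ^ pos i) outer).tail = z i
  degree_z : ∀ i, degree (posSubgraph G σ) (z i) = 2
  degree_eq_three : ∀ x ∈ V(G), x ∉ Set.range z → degree (posSubgraph G σ) x = 3
  negEdge : Fin k → β
  negEdge_injective : Function.Injective negEdge
  range_negEdge : Set.range negEdge = negEdges G σ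
  isLink_negEdge : ∀ i : Fin k,
    G.IsLink (negEdge i) (z ⟨i.1, by have := i.2; omega⟩) (z ⟨i.1 + k, by have := i.2; omega⟩)

/-- `H` is a single face bounded by a 4-cycle: `H` is a cycle with four vertices, and it is the
boundary of a face of the embedding that lies outside the crosscap, i.e. of a face of `G⁺` other
than the outer face. -/
def CanonicalEmbedding.IsFourFace {G : Graph α β} {σ : β → ℤˣ} {k : ℕ}
    (𝓔 : CanonicalEmbedding G σ k) (H : Graph α β) : Prop :=
  IsCycle H ∧ V(H).ncard = 4 ∧
    ∃ d : Dart (posSubgraph G σ), ¬ 𝓔.plane.face.SameCycle 𝓔.outer d ∧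
      𝓔.plane.faceLength d = 4 ∧ 𝓔.plane.faceVerts d = V(H) ∧ 𝓔.plane.faceEdges d = E(H)

end Canonical

end SignedGraph

/-! Write d(A) for the number of edges with exactly one end in A. The signature has k = l(G, σ)
negative edges, so no cut has more negative than positive edges. Deleting a positive edge lowers the
frustration index, so each positive edge lies in a balanced cut, one with equally many edges of both
signs. Moreover G is cubic: the z i have degree 2 in G⁺ and one negative edge each.

One side of a (2,2)-cut has no negative inner edge. Otherwise the ends of a negative edge inside one
side and of one inside the other alternate on the outer circuit C, and C meets the cut in more than
two positive edges (`not_both_sides`).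

Let A be a set all of whose inner edges are positive. Uncrossing A with a balanced cut through an
inner edge separates the ends of that edge by a partition of A into two parts whose d is at most
d(A) (`exists_split`). As d(A) has the parity of |A|, this gives in turn d(A) ≥ 3 if A is nonempty,
|A| = 1 if d(A) = 3, and |A| ≤ 4 if d(A) = 4, the last by crossing two such partitions
(`card_le_four`). Hence the side of the cut is a K₂ or has four vertices, and in the second case the
same inequalities force an induced 4-cycle (`exists_square`).

It remains to see that the 4-cycle is facial. Two of its vertices are ends of the negative cut
edges, so they lie on C and have degree 2 in G⁺, while C also has a vertex off the 4-cycle. At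
vertices of degree 2 or 3 a boundary walk has so few ways to continue that, if the two are
neighbours, the walk on the other side of the 4-cycle closes up after four steps; if they are
opposite, the outer face lies on both sides of an edge or is bounded by the 4-cycle itself
(`boundsFace_of_square`). No face lies on both sides of an edge, since G⁺ is 2-connected: by Euler's
formula such an edge is a bridge, which is proved by linear algebra over the field with two elements
(`exists_bridge_side`). -/

namespace SignedGraph

/-! ### Edge cuts of critical cubic multigraphs, given by the ends of the edges -/

section CutCount

variable {α β : Type*} [DecidableEq α]

/-- The indicator of the edges with exactly one end in `A`. -/
def crossing (u v : β → α) (A : Finset α) (e : β) : ℤ := if (u e ∈ A ↔ v e ∈ A) then 0 else 1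

/-- The number of edges with exactly one end in `A`. -/
def bdry (E : Finset β) (u v : β → α) (A : Finset α) : ℤ := ∑ e ∈ E, crossing u v A e

/-- The edges with both ends in `A`. -/
def inner (E : Finset β) (u v : β → α) (A : Finset α) : Finset β :=
  E.filter fun e => u e ∈ A ∧ v e ∈ A

/-- The edges `E`, with ends `u` and `v`, form a cubic signed graph on `V` all of whose cuts have at
least as many positive as negative edges, and in which each positive edge is in a balanced cut. -/
structure CubicCritical (V : Finset α) (E : Finset β) (u v : β → α) (s : β → ℤ) : Prop where
  left_mem : ∀ e ∈ E, u e ∈ V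
  right_mem : ∀ e ∈ E, v e ∈ V
  degree_eq : ∀ x ∈ V,
    ∑ e ∈ E, ((if u e = x then (1 : ℤ) else 0) + (if v e = x then 1 else 0)) = 3
  sign : ∀ e ∈ E, s e = 1 ∨ s e = -1
  nonneg : ∀ Y : Finset α, 0 ≤ ∑ e ∈ E, s e * crossing u v Y e
  tight : ∀ e ∈ E, s e = 1 →
    ∃ Y : Finset α, crossing u v Y e = 1 ∧ ∑ e ∈ E, s e * crossing u v Y e = 0

variable {V : Finset α} {E : Finset β} {u v : β → α} {s : β → ℤ}

theorem bdry_submodular (A B : Finset α) :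
    bdry E u v (A ∩ B) + bdry E u v (A ∪ B) ≤ bdry E u v A + bdry E u v B := by
  unfold bdry
  rw [← Finset.sum_add_distrib, ← Finset.sum_add_distrib]
  refine Finset.sum_le_sum fun e _ => ?_
  unfold crossing
  by_cases h1 : u e ∈ A <;> by_cases h2 : v e ∈ A <;> by_cases h3 : u e ∈ B <;>
    by_cases h4 : v e ∈ B <;> simp [h1, h2, h3, h4]

namespace CubicCritical

/-- Degree count over A. Its main use is parity: the boundary of A is congruent to |A| modulo 2, and
a set with few boundary edges has inner edges. -/
theorem three_mul_card (h : CubicCritical V E u v s) {A : Finset α} (hA : A ⊆ V) :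
    3 * (A.card : ℤ) = 2 * (inner E u v A).card + bdry E u v A := by
  have h1 : ∑ x ∈ A, ∑ e ∈ E, ((if u e = x then (1 : ℤ) else 0) + (if v e = x then 1 else 0))
      = 3 * A.card := by
    rw [Finset.sum_congr rfl fun x hx => h.degree_eq x (hA hx)]
    simp [mul_comm]
  rw [← h1, Finset.sum_comm, inner, Finset.card_filter]
  push_cast
  rw [Finset.mul_sum, bdry, ← Finset.sum_add_distrib]
  refine Finset.sum_congr rfl fun e _ => ?_
  rw [Finset.sum_add_distrib, Finset.sum_ite_eq, Finset.sum_ite_eq, crossing]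
  by_cases h1 : u e ∈ A <;> by_cases h2 : v e ∈ A <;> simp [h1, h2]

/-- An edge inside an all-positive set `A` is cut by a partition of `A` into two parts whose
boundaries are not larger than that of `A`. -/
theorem exists_split (h : CubicCritical V E u v s) {A : Finset α}
    (hpos : ∀ e ∈ inner E u v A, s e = 1) {f : β} (hf : f ∈ inner E u v A) :
    ∃ D ⊆ A, ¬ (u f ∈ D ↔ v f ∈ D) ∧ bdry E u v D ≤ bdry E u v A ∧
      bdry E u v (A \ D) ≤ bdry E u v A := by
  have hf' := hf
  simp only [inner, Finset.mem_filter] at hf' hpos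
  obtain ⟨Y, hY, hY0⟩ := h.tight f hf'.1 (hpos f hf')
  -- Uncrossing: Y is balanced and Z has nonnegative weight, so summing a termwise bound for the
  -- weight of Z minus that of Y bounds the boundary of the part of A by that of A.
  have key : ∀ Z : Finset α,
      (∀ e ∈ E, s e * crossing u v Z e - s e * crossing u v Y e ≤
        crossing u v A e - crossing u v (A \ Y) e) →
      bdry E u v (A \ Y) ≤ bdry E u v A := by
    intro Z hZ
    have := Finset.sum_le_sum hZ
    rw [Finset.sum_sub_distrib, Finset.sum_sub_distrib, hY0] at this
    have h0 := h.nonneg Z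
    unfold bdry
    linarith
  have key2 : ∀ Z : Finset α,
      (∀ e ∈ E, s e * crossing u v Z e - s e * crossing u v Y e ≤
        crossing u v A e - crossing u v (A ∩ Y) e) →
      bdry E u v (A ∩ Y) ≤ bdry E u v A := by
    intro Z hZ
    have := Finset.sum_le_sum hZ
    rw [Finset.sum_sub_distrib, Finset.sum_sub_distrib, hY0] at this
    have h0 := h.nonneg Z
    unfold bdry
    linarith
  refine ⟨A ∩ Y, Finset.inter_subset_left, ?_, ?_, ?_⟩
  · simpa [crossing, hf'.2] using hY
  -- Positivity inside A is needed only for the edges between A ∩ Y and A \ Y; the other cases hold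
  -- for either sign. The same is true of Y \ A below.
  · refine key2 (Y ∪ A) fun e he => ?_
    have hs := h.sign e he
    have hp := hpos e
    unfold crossing
    by_cases h1 : u e ∈ A <;> by_cases h2 : v e ∈ A <;> by_cases h3 : u e ∈ Y <;>
      by_cases h4 : v e ∈ Y <;> simp [h1, h2, h3, h4, he] at hp ⊢ <;> omega
  · rw [Finset.sdiff_inter_self_left]
    refine key (Y \ A) fun e he => ?_
    have hs := h.sign e he
    have hp := hpos e
    unfold crossing
    by_cases h1 : u e ∈ A <;> by_cases h2 : v e ∈ A <;> by_cases h3 : u e ∈ Y <;>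
      by_cases h4 : v e ∈ Y <;> simp [h1, h2, h3, h4, he] at hp ⊢ <;> omega

end CubicCritical

theorem inner_mono {A B : Finset α} (hAB : A ⊆ B) : inner E u v A ⊆ inner E u v B := by
  intro e he
  simp only [inner, Finset.mem_filter] at he ⊢
  exact ⟨he.1, hAB he.2.1, hAB he.2.2⟩

namespace CubicCritical

theorem exists_proper_split (h : CubicCritical V E u v s) {A : Finset α}
    (hpos : ∀ e ∈ inner E u v A, s e = 1) {f : β} (hf : f ∈ inner E u v A) :
    ∃ D ⊆ A, ¬ (u f ∈ D ↔ v f ∈ D) ∧ D.Nonempty ∧ (A \ D).Nonempty ∧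
      bdry E u v D ≤ bdry E u v A ∧ bdry E u v (A \ D) ≤ bdry E u v A := by
  obtain ⟨D, hDA, hD, h1, h2⟩ := h.exists_split hpos hf
  simp only [inner, Finset.mem_filter] at hf
  refine ⟨D, hDA, hD, ?_, ?_, h1, h2⟩
  · by_contra hne
    rw [Finset.not_nonempty_iff_eq_empty] at hne
    simp [hne] at hD
  · by_contra hne
    rw [Finset.not_nonempty_iff_eq_empty, Finset.sdiff_eq_empty_iff_subset] at hne
    exact hD ⟨fun _ => hne hf.2.2, fun _ => hne hf.2.1⟩

/-- In a minimal counterexample the degree count yields an inner edge, and a part of the partition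
that cuts it is a smaller counterexample. -/
theorem three_le_bdry (h : CubicCritical V E u v s) (A : Finset α) (hA : A ⊆ V)
    (hpos : ∀ e ∈ inner E u v A, s e = 1) (hne : A.Nonempty) : 3 ≤ bdry E u v A := by
  induction A using Finset.strongInduction with
  | H A ih =>
    by_contra hlt
    push Not at hlt
    have hc := h.three_mul_card hA
    have hA0 := hne.card_pos
    have : 0 < (inner E u v A).card := by omega
    obtain ⟨f, hf⟩ := Finset.card_pos.mp this
    obtain ⟨D, hDA, -, hD, hD', h1, -⟩ := h.exists_proper_split hpos hf
    have hss : D ⊂ A := by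
      refine ⟨hDA, fun hAD => ?_⟩
      rw [Finset.sdiff_eq_empty_iff_subset.mpr hAD] at hD'
      simp at hD'
    have := ih D hss (hDA.trans hA) (fun e he => hpos e (inner_mono hDA he)) hD
    omega

/-- An inner edge would split A into two nonempty parts with exactly three boundary edges each. Both
parts and A itself would be odd, which is impossible. -/
theorem card_eq_one (h : CubicCritical V E u v s) {A : Finset α} (hA : A ⊆ V)
    (hpos : ∀ e ∈ inner E u v A, s e = 1) (hd : bdry E u v A = 3) : A.card = 1 := by
  have hc := h.three_mul_card hA
  by_contra hne
  have : 0 < (inner E u v A).card := by omega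
  obtain ⟨f, hf⟩ := Finset.card_pos.mp this
  obtain ⟨D, hDA, -, hD, hD', h1, h2⟩ := h.exists_proper_split hpos hf
  have h3 := h.three_le_bdry D (hDA.trans hA) (fun e he => hpos e (inner_mono hDA he)) hD
  have h4 := h.three_le_bdry (A \ D) (Finset.sdiff_subset.trans hA)
    (fun e he => hpos e (inner_mono Finset.sdiff_subset he)) hD'
  have h5 := h.three_mul_card (hDA.trans hA)
  have h6 := h.three_mul_card (Finset.sdiff_subset.trans hA : A \ D ⊆ V)
  have h7 := Finset.card_sdiff_add_card_eq_card hDA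
  omega

/-- The boundary of a set of at least two vertices has at least four edges, and at least five if the
set is odd, since the boundary has the parity of the set. -/
theorem four_le_bdry (h : CubicCritical V E u v s) {A : Finset α} (hA : A ⊆ V)
    (hpos : ∀ e ∈ inner E u v A, s e = 1) (hne : 2 ≤ A.card) :
    4 ≤ bdry E u v A ∧ (Odd A.card → 5 ≤ bdry E u v A) := by
  have h3 := h.three_le_bdry A hA hpos (Finset.card_pos.mp (by omega))
  have h1 : bdry E u v A ≠ 3 := fun hd => by
    have := h.card_eq_one hA hpos hd
    omega
  have hc := h.three_mul_card hA
  refine ⟨by omega, fun ⟨m, hm⟩ => by omega⟩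

/-- Every inner edge of a set with four boundary edges is cut by a partition into two such sets,
unless the set has only two vertices. -/
theorem exists_four_split (h : CubicCritical V E u v s) {A : Finset α} (hA : A ⊆ V)
    (hpos : ∀ e ∈ inner E u v A, s e = 1) (hd : bdry E u v A = 4) (hcard : 2 < A.card)
    {f : β} (hf : f ∈ inner E u v A) :
    ∃ D ⊆ A, ¬ (u f ∈ D ↔ v f ∈ D) ∧ D.Nonempty ∧ (A \ D).Nonempty ∧
      bdry E u v D = 4 ∧ bdry E u v (A \ D) = 4 := by
  obtain ⟨D, hDA, hfD, hD, hD', h1, h2⟩ := h.exists_proper_split hpos hf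
  have hp1 : ∀ e ∈ inner E u v D, s e = 1 := fun e he => hpos e (inner_mono hDA he)
  have hp2 : ∀ e ∈ inner E u v (A \ D), s e = 1 :=
    fun e he => hpos e (inner_mono Finset.sdiff_subset he)
  have hV1 := hDA.trans hA
  have hV2 := (Finset.sdiff_subset.trans hA : A \ D ⊆ V)
  have h3 := h.three_le_bdry D hV1 hp1 hD
  have h4 := h.three_le_bdry (A \ D) hV2 hp2 hD'
  have h5 := h.three_mul_card hV1
  have h6 := h.three_mul_card hV2
  have h7 := Finset.card_sdiff_add_card_eq_card hDA
  have h8 := h.three_mul_card hA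
  -- Both boundaries are 3 or 4, and they have the same parity because A is even. If both are 3, the
  -- parts are single vertices, but A has more than two.
  have h9 : ¬ (bdry E u v D = 3 ∧ bdry E u v (A \ D) = 3) := fun h10 => by
    have := h.card_eq_one hV1 hp1 h10.1
    have := h.card_eq_one hV2 hp2 h10.2
    omega
  exact ⟨D, hDA, hfD, hD, hD', by omega, by omega⟩

set_option maxHeartbeats 1000000 in
-- Among the partitions of A into two parts with four boundary edges each, take a smallest part D.
-- It has an inner edge, which is cut by another such partition, with part D₂. Submodularity applied
-- to the four quadrants either yields a smaller part than D or shows that A \ D has only two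
-- vertices.
theorem card_le_four (h : CubicCritical V E u v s) {A : Finset α} (hA : A ⊆ V)
    (hpos : ∀ e ∈ inner E u v A, s e = 1) (hd : bdry E u v A = 4) : A.card ≤ 4 := by
  by_contra! hcard
  have hc := h.three_mul_card hA
  have sub : ∀ B : Finset α, B ⊆ A → ((3 * (B.card : ℤ) = 2 * (inner E u v B).card + bdry E u v B) ∧
      (B.Nonempty → 3 ≤ bdry E u v B) ∧ (2 ≤ B.card → 4 ≤ bdry E u v B) ∧
      (bdry E u v B = 3 → B.card = 1)) := fun B hB =>
    have hp : ∀ e ∈ inner E u v B, s e = 1 := fun e he => hpos e (inner_mono hB he)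
    ⟨h.three_mul_card (hB.trans hA), h.three_le_bdry B (hB.trans hA) hp,
      fun h2 => (h.four_le_bdry (hB.trans hA) hp h2).1, h.card_eq_one (hB.trans hA) hp⟩
  have hex : ∃ D ∈ A.powerset.filter (fun D => D.Nonempty ∧ (A \ D).Nonempty ∧
      bdry E u v D = 4 ∧ bdry E u v (A \ D) = 4), True := by
    have : 0 < (inner E u v A).card := by omega
    obtain ⟨f, hf⟩ := Finset.card_pos.mp this
    obtain ⟨D, hDA, -, hD⟩ := h.exists_four_split hA hpos hd (by omega) hf
    exact ⟨D, by simpa [hDA] using hD, trivial⟩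
  obtain ⟨D, hD, -⟩ := hex
  obtain ⟨D, hD, hmin⟩ := Finset.exists_min_image _ Finset.card ⟨D, hD⟩
  simp only [Finset.mem_filter, Finset.mem_powerset] at hD hmin
  obtain ⟨hDA, hDne, hDne', hd1, hd2⟩ := hD
  obtain ⟨c1, -, -, -⟩ := sub D hDA
  have ev : ∀ B ⊆ A, bdry E u v B = 4 → ∃ m, B.card = 2 * m := fun B hB hB4 =>
    ⟨B.card / 2, by have := (sub B hB).1; omega⟩
  have : 0 < (inner E u v D).card := by have := hDne.card_pos; omega
  obtain ⟨g, hg⟩ := Finset.card_pos.mp this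
  obtain ⟨D₂, hDA₂, hgD, hD₂, hD₂', hd3, hd4⟩ :=
    h.exists_four_split hA hpos hd (by omega) (inner_mono hDA hg)
  simp only [inner, Finset.mem_filter] at hg
  -- the four quadrants of `A`
  have hn1 : (D ∩ D₂).Nonempty := by
    by_contra hne
    rw [Finset.not_nonempty_iff_eq_empty, Finset.eq_empty_iff_forall_notMem] at hne
    simp only [Finset.mem_inter, not_and] at hne
    exact hgD ⟨fun h1 => absurd h1 (hne _ hg.2.1), fun h1 => absurd h1 (hne _ hg.2.2)⟩
  have hn2 : (D \ D₂).Nonempty := by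
    by_contra hne
    rw [Finset.not_nonempty_iff_eq_empty, Finset.sdiff_eq_empty_iff_subset] at hne
    exact hgD ⟨fun _ => hne hg.2.2, fun _ => hne hg.2.1⟩
  have k1 := Finset.card_sdiff_add_card_eq_card hDA
  have k2 := Finset.card_sdiff_add_card_eq_card hDA₂
  have k3 := Finset.card_sdiff_add_card_inter D D₂
  have k4 := Finset.card_sdiff_add_card_inter D₂ D
  have k4' : (D₂ ∩ D).card = (D ∩ D₂).card := by rw [Finset.inter_comm]
  have k5 := Finset.card_union_add_card_inter D D₂
  have p1 := hn1.card_pos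
  have p2 := hn2.card_pos
  have uA : D ∪ D₂ ⊆ A := Finset.union_subset hDA hDA₂
  have iA : D ∩ D₂ ⊆ A := Finset.inter_subset_left.trans hDA
  have q1 := Finset.card_sdiff_add_card_eq_card uA
  have q2 := Finset.card_sdiff_add_card_eq_card iA
  have s1 := bdry_submodular (E := E) (u := u) (v := v) D D₂
  have s2 := bdry_submodular (E := E) (u := u) (v := v) (A \ D) (A \ D₂)
  have e1 : (A \ D) ∩ (A \ D₂) = A \ (D ∪ D₂) := by
    ext x; simp only [Finset.mem_inter, Finset.mem_sdiff, Finset.mem_union]; tauto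
  have e2 : (A \ D) ∪ (A \ D₂) = A \ (D ∩ D₂) := by
    ext x; simp only [Finset.mem_inter, Finset.mem_sdiff, Finset.mem_union]; tauto
  have s3 := bdry_submodular (E := E) (u := u) (v := v) D (A \ D₂)
  have e3 : D ∩ (A \ D₂) = D \ D₂ := by
    ext x; simp only [Finset.mem_inter, Finset.mem_sdiff]
    exact ⟨fun h => ⟨h.1, h.2.2⟩, fun h => ⟨h.1, hDA h.1, h.2⟩⟩
  have s4 := bdry_submodular (E := E) (u := u) (v := v) (A \ D) D₂
  have e4 : (A \ D) ∩ D₂ = D₂ \ D := by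
    ext x; simp only [Finset.mem_inter, Finset.mem_sdiff]
    exact ⟨fun h => ⟨h.2, h.1.2⟩, fun h => ⟨⟨hDA₂ h.1, h.2⟩, h.1⟩⟩
  have e5 : (A \ D) ∪ D₂ = A \ (D \ D₂) := by
    ext x; simp only [Finset.mem_union, Finset.mem_sdiff]
    have := @hDA₂ x
    tauto
  have iA' : D \ D₂ ⊆ A := Finset.sdiff_subset.trans hDA
  have q3 := Finset.card_sdiff_add_card_eq_card iA'
  have iA'' : D₂ \ D ⊆ A := Finset.sdiff_subset.trans hDA₂
  have e6 : D ∪ (A \ D₂) = A \ (D₂ \ D) := by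
    ext x; simp only [Finset.mem_union, Finset.mem_sdiff]
    have := @hDA x
    tauto
  rw [e1, e2] at s2
  rw [e3, e6] at s3
  rw [e4, e5] at s4
  have t1 := sub _ iA
  have t2 := sub _ iA'
  have t3 := sub _ uA
  have t4 := sub _ (Finset.sdiff_subset : A \ (D ∪ D₂) ⊆ A)
  have t5 := sub _ (Finset.sdiff_subset : A \ (D ∩ D₂) ⊆ A)
  have t6 := sub _ (Finset.sdiff_subset : A \ (D \ D₂) ⊆ A)
  have t7 := sub _ iA''
  have t8 := sub _ (Finset.sdiff_subset : A \ (D₂ \ D) ⊆ A)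
  have q4 := Finset.card_sdiff_add_card_eq_card iA''
  have m1 := hmin (D ∩ D₂)
  have m2 := hmin (D \ D₂)
  have z1 : 3 ≤ bdry E u v (D ∩ D₂) := t1.2.1 hn1
  have z2 : 3 ≤ bdry E u v (D \ D₂) := t2.2.1 hn2
  have n5 : (A \ (D ∩ D₂)).Nonempty := Finset.card_pos.mp (by omega)
  have n6 : (A \ (D \ D₂)).Nonempty := Finset.card_pos.mp (by omega)
  simp only [iA, hn1, n5, true_and, and_imp] at m1
  simp only [iA', hn2, n6, true_and, and_imp] at m2
  have n4 : (A \ (D ∪ D₂)).card = 0 ∨ 3 ≤ bdry E u v (A \ (D ∪ D₂)) := by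
    rcases Finset.eq_empty_or_nonempty (A \ (D ∪ D₂)) with h0 | h0
    · left; simp [h0]
    · right; exact t4.2.1 h0
  have n7 : (D₂ \ D).card = 0 ∨ 3 ≤ bdry E u v (D₂ \ D) := by
    rcases Finset.eq_empty_or_nonempty (D₂ \ D) with h0 | h0
    · left; simp [h0]
    · right; exact t7.2.1 h0
  have hDc : 0 < (A \ D).card := hDne'.card_pos
  -- Both D ∩ D₂ and D \ D₂ are proper subsets of D, so by minimality neither can be a part of an
  -- admissible partition.
  have key : bdry E u v (A \ (D ∩ D₂)) = 4 → bdry E u v (D ∩ D₂) = 4 → False := fun ha hb => by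
    have := m1 hb ha
    omega
  have key2 : bdry E u v (A \ (D \ D₂)) = 4 → bdry E u v (D \ D₂) = 4 → False := fun ha hb => by
    have := m2 hb ha
    omega
  -- The complementary part competes in the minimum as well.
  have hDA' : D.card ≤ (A \ D).card := by
    refine hmin (A \ D) ⟨Finset.sdiff_subset, hDne', ?_⟩
    rw [Finset.sdiff_sdiff_eq_self hDA]
    exact ⟨hDne, hd2, hd1⟩
  have l1 := t1.1
  have l2 := t2.1
  have l4 := t4.1
  have l5 := t5.1
  have l6 := t6.1
  have l7 := t7.1
  have x3 := t3.2.2.1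
  have x5 := t5.2.2.1
  have x6 := t6.2.2.1
  have x8 := t8.2.2.1
  have x4 := t4.2.2.2
  have x7 := t7.2.2.2
  clear t1 t2 t3 t4 t5 t6 t7 t8 sub hmin m1 m2
  -- A, D and D₂ are even, so all four quadrants have the same parity. If they are even, the
  -- nonempty ones have at least four boundary edges, and equality in the submodular inequalities
  -- contradicts minimality. Which pair of opposite quadrants is used depends on whether A \ (D ∪
  -- D₂) is empty.
  rcases Nat.even_or_odd (D ∩ D₂).card with ⟨i, hi⟩ | ⟨i, hi⟩
  · have y1 : 4 ≤ bdry E u v (D ∩ D₂) := by omega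
    have y3 := x3 (by omega)
    have y5 := x5 (by omega)
    rcases n4 with n4 | n4
    · have y2 : 4 ≤ bdry E u v (D \ D₂) := by omega
      have y6 := x6 (by omega)
      have y8 := x8 (by omega)
      exact key2 (by omega) (by omega)
    · exact key (by omega) (by omega)
  · have y5 := x5 (by omega)
    have y6 := x6 (by omega)
    obtain ⟨a, ha⟩ := ev A subset_rfl hd
    obtain ⟨b, hb⟩ := ev D hDA hd1
    obtain ⟨c, hc⟩ := ev D₂ hDA₂ hd3
    -- In the odd case all quadrants are nonempty and the complement of one has at least five
    -- boundary edges. This leaves three for each quadrant of A \ D, so both are single vertices,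
    -- and |A| ≤ 2 |A \ D| = 4.
    have y5' : 5 ≤ bdry E u v (A \ (D ∩ D₂)) := by clear n4 n7 s1 s2 s3 s4; omega
    have y6' : 5 ≤ bdry E u v (A \ (D \ D₂)) := by clear n4 n7 s1 s2 s3 s4; omega
    have n4' := n4.resolve_left (by clear n7 s1 s2 s3 s4; omega)
    have n7' := n7.resolve_left (by clear n4 s1 s2 s3 s4; omega)
    have w4 : bdry E u v (A \ (D ∪ D₂)) = 3 := by linarith
    have w7 : bdry E u v (D₂ \ D) = 3 := by linarith
    have := x4 w4
    have := x7 w7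
    omega

end CubicCritical

/-- The edge `e` has ends `a` and `b`. -/
def Joins (u v : β → α) (e : β) (a b : α) : Prop := (u e = a ∧ v e = b) ∨ (u e = b ∧ v e = a)

/-! ### The structure of four-vertex sets with four boundary edges. -/

namespace CubicCritical

theorem ne_of_mem_inner (h : CubicCritical V E u v s) {A : Finset α} (hA : A ⊆ V)
    (hpos : ∀ e ∈ inner E u v A, s e = 1) {e : β} (he : e ∈ inner E u v A) : u e ≠ v e := by
  intro huv
  have he' := he
  simp only [inner, Finset.mem_filter] at he'
  have hs : {u e} ⊆ A := by simpa using he'.2.1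
  have h1 := h.three_mul_card (hs.trans hA)
  have h2 := h.three_le_bdry {u e} (hs.trans hA) (fun e he => hpos e (inner_mono hs he)) (by simp)
  have h3 : 0 < (inner E u v {u e}).card :=
    Finset.card_pos.mpr ⟨e, by simp [inner, he'.1, huv]⟩
  simp at h1
  omega

/-- Of the six edge ends at two vertices of A at least four belong to boundary edges of the pair,
which leaves room for one edge between them. -/
theorem eq_of_joins (h : CubicCritical V E u v s) {A : Finset α} (hA : A ⊆ V)
    (hpos : ∀ e ∈ inner E u v A, s e = 1) {e f : β} (he : e ∈ inner E u v A)
    (hf : f ∈ inner E u v A) {a b : α} (hea : Joins u v e a b) (hfa : Joins u v f a b) : e = f := by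
  have hne := h.ne_of_mem_inner hA hpos he
  have he' := he
  have hf' := hf
  simp only [inner, Finset.mem_filter] at he' hf'
  have hab : a ≠ b := by
    rintro rfl
    rcases hea with h1 | h1 <;> exact hne (h1.1.trans h1.2.symm)
  have hs : {a, b} ⊆ A := by
    rw [Finset.insert_subset_iff, Finset.singleton_subset_iff]
    rcases hea with ⟨rfl, rfl⟩ | ⟨rfl, rfl⟩
    · exact he'.2
    · exact he'.2.symm
  have h1 := h.three_mul_card (hs.trans hA)
  have h2 := (h.four_le_bdry (hs.trans hA) (fun e he => hpos e (inner_mono hs he))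
    (by rw [Finset.card_pair hab])).1
  rw [Finset.card_pair hab] at h1
  have h3 : (inner E u v {a, b}).card ≤ 1 := by omega
  refine Finset.card_le_one.mp h3 e ?_ f ?_
  · rcases hea with h4 | h4 <;> simp [inner, he'.1, h4]
  · rcases hfa with h4 | h4 <;> simp [inner, hf'.1, h4]

open Classical in
-- A has four inner edges. The other three vertices form an odd set with at least five boundary
-- edges, hence with at most two inner edges, so each vertex is on at least two inner edges of A.
-- These numbers sum to eight, so all are equal to two.
theorem card_inner_at (h : CubicCritical V E u v s) {A : Finset α} (hA : A ⊆ V)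
    (hpos : ∀ e ∈ inner E u v A, s e = 1) (hd : bdry E u v A = 4) (hc : A.card = 4)
    {x : α} (hx : x ∈ A) : ((inner E u v A).filter fun e => u e = x ∨ v e = x).card = 2 := by
  have hi : (inner E u v A).card = 4 := by
    have := h.three_mul_card hA
    omega
  have hle : ∀ y ∈ A, (2 : ℕ) ≤ ((inner E u v A).filter fun e => u e = y ∨ v e = y).card := by
    intro y hy
    have h1 := h.three_mul_card ((Finset.erase_subset y A).trans hA)
    have hc1 := Finset.card_erase_of_mem hy
    have h2 := (h.four_le_bdry ((Finset.erase_subset y A).trans hA)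
      (fun e he => hpos e (inner_mono (Finset.erase_subset y A) he)) (by omega)).2
      (by rw [hc1, hc]; decide)
    have h3 : (inner E u v A).filter (fun e => ¬ (u e = y ∨ v e = y)) =
        inner E u v (A.erase y) := by
      ext e
      simp only [inner, Finset.mem_filter, Finset.mem_erase]
      tauto
    have h4 := Finset.card_filter_add_card_filter_not (s := inner E u v A)
      (fun e => u e = y ∨ v e = y)
    rw [h3] at h4
    omega
  have hsum : ∑ y ∈ A, ((inner E u v A).filter fun e => u e = y ∨ v e = y).card = ∑ y ∈ A, 2 := by
    simp_rw [Finset.card_filter]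
    rw [Finset.sum_comm, Finset.sum_const, hc]
    rw [Finset.sum_congr rfl (g := fun _ => 2), Finset.sum_const, hi]
    intro e he
    have hne := h.ne_of_mem_inner hA hpos he
    simp only [inner, Finset.mem_filter] at he
    rw [← Finset.card_filter]
    have : A.filter (fun y => u e = y ∨ v e = y) = {u e, v e} := by
      ext y
      simp only [Finset.mem_filter, Finset.mem_insert, Finset.mem_singleton]
      constructor
      · rintro ⟨-, rfl | rfl⟩ <;> simp
      · rintro (rfl | rfl) <;> simp [he.2]
    rw [this, Finset.card_pair hne]
  exact ((Finset.sum_eq_sum_iff_of_le hle).mp hsum.symm x hx).symm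

theorem exists_two_at (h : CubicCritical V E u v s) {A : Finset α} (hA : A ⊆ V)
    (hpos : ∀ e ∈ inner E u v A, s e = 1) (hd : bdry E u v A = 4) (hc : A.card = 4)
    {x : α} (hx : x ∈ A) : ∃ e₁ ∈ inner E u v A, ∃ e₂ ∈ inner E u v A, ∃ y₁ ∈ A, ∃ y₂ ∈ A,
      Joins u v e₁ x y₁ ∧ Joins u v e₂ x y₂ ∧ y₁ ≠ y₂ ∧ y₁ ≠ x ∧ y₂ ≠ x ∧
      ∀ e ∈ inner E u v A, (u e = x ∨ v e = x) → e = e₁ ∨ e = e₂ := by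
  classical
  obtain ⟨e₁, e₂, he, hee⟩ := Finset.card_eq_two.mp (h.card_inner_at hA hpos hd hc hx)
  have hj : ∀ e ∈ inner E u v A, (u e = x ∨ v e = x) → ∃ y ∈ A, Joins u v e x y ∧ y ≠ x := by
    intro e he hex
    have hne := h.ne_of_mem_inner hA hpos he
    simp only [inner, Finset.mem_filter] at he
    rcases hex with rfl | rfl
    · exact ⟨v e, he.2.2, Or.inl ⟨rfl, rfl⟩, hne.symm⟩
    · exact ⟨u e, he.2.1, Or.inr ⟨rfl, rfl⟩, hne⟩
  have h1 := Finset.ext_iff.mp hee e₁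
  have h2 := Finset.ext_iff.mp hee e₂
  simp only [Finset.mem_filter, Finset.mem_insert, Finset.mem_singleton, true_or, or_true,
    iff_true] at h1 h2
  obtain ⟨y₁, hy₁, j₁, n₁⟩ := hj e₁ h1.1 h1.2
  obtain ⟨y₂, hy₂, j₂, n₂⟩ := hj e₂ h2.1 h2.2
  refine ⟨e₁, h1.1, e₂, h2.1, y₁, hy₁, y₂, hy₂, j₁, j₂, ?_, n₁, n₂, fun e he hex => ?_⟩
  · rintro rfl
    exact he (h.eq_of_joins hA hpos h1.1 h2.1 j₁ j₂)
  · have := Finset.ext_iff.mp hee e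
    simpa [he, hex] using this

/-- A set of four vertices with four boundary edges and without negative inner edges induces a
4-cycle. -/
theorem exists_square (h : CubicCritical V E u v s) {A : Finset α} (hA : A ⊆ V)
    (hpos : ∀ e ∈ inner E u v A, s e = 1) (hd : bdry E u v A = 4) (hc : A.card = 4)
    {x : α} (hx : x ∈ A) : ∃ y₁ y₂ w e₁ e₂ e₃ e₄, A = {x, y₁, w, y₂} ∧
      (x ≠ y₁ ∧ x ≠ w ∧ x ≠ y₂ ∧ y₁ ≠ w ∧ y₁ ≠ y₂ ∧ w ≠ y₂) ∧
      Joins u v e₁ x y₁ ∧ Joins u v e₂ y₁ w ∧ Joins u v e₃ w y₂ ∧ Joins u v e₄ y₂ x ∧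
      ∀ e, e ∈ inner E u v A ↔ e = e₁ ∨ e = e₂ ∨ e = e₃ ∨ e = e₄ := by
  classical
  have jc : ∀ {e a b}, Joins u v e a b → Joins u v e b a := fun h => h.symm.imp id id
  have jn : ∀ {e a b}, Joins u v e a b → u e = a ∨ v e = a := fun h =>
    h.imp (·.1) (·.2)
  have jd : ∀ {e f a b c d}, Joins u v e a b → Joins u v f c d → a ≠ c → a ≠ d → e ≠ f := by
    rintro e f a b c d h1 h2 h3 h4 rfl
    rcases jn h1 with rfl | rfl <;> rcases h2 with h2 | h2
    exacts [h3 h2.1, h4 h2.1, h4 h2.2, h3 h2.2]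
  obtain ⟨e₁, h₁, e₄, h₄, y₁, hy₁, y₂, hy₂, j₁, j₄, hy, n₁, n₂, hall⟩ :=
    h.exists_two_at hA hpos hd hc hx
  have h3 : ({x, y₁, y₂} : Finset α).card = 3 := by
    rw [Finset.card_eq_three]; exact ⟨x, y₁, y₂, n₁.symm, n₂.symm, hy, rfl⟩
  obtain ⟨w, hwA, hw⟩ := Finset.exists_mem_notMem_of_card_lt_card
    (show ({x, y₁, y₂} : Finset α).card < A.card by omega)
  simp only [Finset.mem_insert, Finset.mem_singleton, not_or] at hw
  have h4 : ({x, y₁, w, y₂} : Finset α).card = 4 := by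
    have hx' : x ∉ ({y₁, w, y₂} : Finset α) := by simp [n₁.symm, n₂.symm, Ne.symm hw.1]
    rw [Finset.card_insert_of_notMem hx',
      Finset.card_eq_three.mpr ⟨y₁, w, y₂, Ne.symm hw.2.1, hy, hw.2.2, rfl⟩]
  have hAeq : A = {x, y₁, w, y₂} := by
    symm
    apply Finset.eq_of_subset_of_card_le
    · intro t
      simp only [Finset.mem_insert, Finset.mem_singleton]
      rintro (rfl | rfl | rfl | rfl) <;> assumption
    · omega
  obtain ⟨e₂, h₂, e₃, h₃, a, ha, b, hb, j₂, j₃, hab, na, nb, hall'⟩ :=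
    h.exists_two_at hA hpos hd hc hwA
  -- The fourth vertex w is not adjacent to x, whose two inner edges end in y₁ and y₂. Hence the two
  -- inner edges at w end there too.
  have hend : ∀ e ∈ inner E u v A, ∀ c ∈ A, Joins u v e w c → c ≠ w → c = y₁ ∨ c = y₂ := by
    intro e he c hcA hj hcw
    rw [hAeq] at hcA
    simp only [Finset.mem_insert, Finset.mem_singleton] at hcA
    rcases hcA with rfl | hcA | hcA | hcA
    · exfalso
      rcases hall e he (jn (jc hj)) with rfl | rfl
      · exact jd hj j₁ hw.1 hw.2.1 rfl
      · exact jd hj j₄ hw.1 hw.2.2 rfl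
    · exact Or.inl hcA
    · exact absurd hcA hcw
    · exact Or.inr hcA
  have fin : ∀ e₂ ∈ inner E u v A, ∀ e₃ ∈ inner E u v A, Joins u v e₂ w y₁ → Joins u v e₃ w y₂ →
      ∀ e, e ∈ inner E u v A ↔ e = e₁ ∨ e = e₂ ∨ e = e₃ ∨ e = e₄ := by
    intro e₂ h₂ e₃ h₃ j₂ j₃
    have hsub : ({e₁, e₂, e₃, e₄} : Finset β) ⊆ inner E u v A := by
      intro t
      simp only [Finset.mem_insert, Finset.mem_singleton]
      rintro (rfl | rfl | rfl | rfl) <;> assumption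
    have hcard : ({e₁, e₂, e₃, e₄} : Finset β).card = 4 := by
      have d12 := jd j₁ j₂ (Ne.symm hw.1) n₁.symm
      have d13 := jd j₁ j₃ (Ne.symm hw.1) n₂.symm
      have d14 := jd (jc j₁) j₄ n₁ hy
      have d23 := jd (jc j₂) j₃ (Ne.symm hw.2.1) hy
      have d24 := jd j₂ j₄ hw.1 hw.2.2
      have d34 := jd j₃ j₄ hw.1 hw.2.2
      have h1' : e₁ ∉ ({e₂, e₃, e₄} : Finset β) := by simp [d12, d13, d14]
      rw [Finset.card_insert_of_notMem h1',
        Finset.card_eq_three.mpr ⟨e₂, e₃, e₄, d23, d24, d34, rfl⟩]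
    have hi := h.three_mul_card hA
    have := Finset.eq_of_subset_of_card_le hsub (by omega)
    intro e
    rw [← this]
    simp
  rcases hend e₂ h₂ a ha j₂ na with rfl | rfl <;> rcases hend e₃ h₃ b hb j₃ nb with rfl | rfl
  · exact absurd rfl hab
  · exact ⟨a, b, w, e₁, e₂, e₃, e₄, hAeq,
      ⟨n₁.symm, Ne.symm hw.1, n₂.symm, Ne.symm hw.2.1, hy, hw.2.2⟩, j₁, jc j₂, j₃, jc j₄,
      fin _ h₂ _ h₃ j₂ j₃⟩
  · exact ⟨b, a, w, e₁, e₃, e₂, e₄, hAeq,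
      ⟨n₁.symm, Ne.symm hw.1, n₂.symm, Ne.symm hw.2.1, hy, hw.2.2⟩, j₁, jc j₃, j₂, jc j₄,
      fin _ h₃ _ h₂ j₃ j₂⟩
  · exact absurd rfl hab

end CubicCritical
end CutCount

/-! ### Plane graphs as rotation systems: Euler's formula and the two sides of an edge. -/

section Plane

variable {α β : Type*} {G : Graph α β}

theorem IsFinite.finite_dart (hG : IsFinite G) : Finite (Dart G) := by
  have h1 := hG.1.to_subtype
  have h2 := hG.2.to_subtype
  refine Finite.of_injective (β := E(G) × V(G) × V(G))
    (fun d => (⟨d.edge, d.isLink.edge_mem⟩, ⟨d.tail, d.isLink.left_mem⟩, ⟨d.head, d.isLink.right_mem⟩)) ?_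
  intro d d' h
  simp only [Prod.mk.injEq, Subtype.mk.injEq] at h
  exact Dart.ext h.1 h.2.1 h.2.2

namespace Dart

@[simp] theorem flip_edge (d : Dart G) : d.flip.edge = d.edge := rfl
@[simp] theorem flip_tail (d : Dart G) : d.flip.tail = d.head := rfl
@[simp] theorem flip_head (d : Dart G) : d.flip.head = d.tail := rfl
@[simp] theorem flip_flip (d : Dart G) : d.flip.flip = d := rfl

theorem tail_ne_head [hl : G.Loopless] (d : Dart G) : d.tail ≠ d.head := by
  intro h
  have := d.isLink
  rw [← h] at this
  exact hl.not_isLoopAt d.edge d.tail this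

theorem eq_or_eq_flip {d d' : Dart G} (h : d'.edge = d.edge) : d' = d ∨ d' = d.flip := by
  have h1 := d'.isLink
  rw [h] at h1
  rcases d.isLink.eq_and_eq_or_eq_and_eq h1 with h2 | h2
  · exact Or.inl (Dart.ext h h2.1.symm h2.2.symm)
  · exact Or.inr (Dart.ext h h2.2.symm h2.1.symm)

theorem flip_ne [G.Loopless] (d : Dart G) : d.flip ≠ d := fun h => d.tail_ne_head (congrArg head h)

end Dart

namespace PlaneEmbedding

variable (M : PlaneEmbedding G)

theorem face_apply (d : Dart G) : M.face d = M.next d.flip := rfl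

theorem tail_face (d : Dart G) : (M.face d).tail = d.head := M.tail_next d.flip

/-- The rotation is the composition of reversal and `face`, so y is constant around each vertex;
reversal carries the value across edges, and the graph is connected. -/
theorem const_of_invariant {R : Type*} (y : Dart G → R) (hface : ∀ d, y (M.face d) = y d)
    (hflip : ∀ d : Dart G, y d.flip = y d) (d d' : Dart G) : y d = y d' := by
  have hnext : ∀ d, y (M.next d) = y d := fun d => by
    have := hface d.flip
    rw [face_apply, Dart.flip_flip, hflip] at this
    exact this
  have hcyc : ∀ d d', M.next.SameCycle d d' → y d = y d' := by
    have hp : ∀ (n : ℕ) (d), y ((M.next ^ n) d) = y d := by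
      intro n
      induction n with
      | zero => simp
      | succ n ih => intro d; rw [pow_succ', Equiv.Perm.mul_apply, hnext, ih]
    rintro d d' ⟨n, rfl⟩
    obtain ⟨n, rfl | rfl⟩ := n.eq_nat_or_neg
    · exact (hp n d).symm
    · have := hp n ((M.next ^ (-(n : ℤ))) d)
      rw [← Equiv.Perm.mul_apply, ← zpow_natCast, ← zpow_add] at this
      simpa using this
  have hwalk : ∀ a b, Relation.ReflTransGen G.Adj a b → ∀ d d' : Dart G, d.tail = a → d'.tail = b →
      y d = y d' := by
    intro a b hab
    induction hab with
    | refl => exact fun d d' h h' => hcyc _ _ (M.sameCycle_of_tail_eq _ _ (h.trans h'.symm))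
    | tail _ hbc ih =>
      intro d d' h h'
      obtain ⟨e, he⟩ := hbc
      let g : Dart G := ⟨e, _, _, he⟩
      rw [ih d g h rfl, ← hflip g]
      exact hcyc _ _ (M.sameCycle_of_tail_eq _ _ h'.symm)
  exact hwalk _ _ (M.connected.2 _ d.isLink.left_mem _ d'.isLink.left_mem) d d' rfl rfl

theorem const_of_adj {R : Type*} (hG : Connected G) (x : V(G) → R)
    (hx : ∀ d : Dart G, x ⟨d.tail, d.isLink.left_mem⟩ = x ⟨d.head, d.isLink.right_mem⟩)
    (a b : V(G)) : x a = x b := by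
  have : ∀ b, Relation.ReflTransGen G.Adj a b → ∃ hb : b ∈ V(G), x a = x ⟨b, hb⟩ := by
    intro b hab
    induction hab with
    | refl => exact ⟨a.2, rfl⟩
    | tail _ hbc ih =>
      obtain ⟨e, he⟩ := hbc
      obtain ⟨hb, h⟩ := ih
      exact ⟨he.right_mem, h.trans (hx ⟨e, _, _, he⟩)⟩
  obtain ⟨_, h⟩ := this b (hG.2 _ a.2 _ b.2)
  exact h

open Classical in
/-- In a plane graph, an edge with the same face on both sides is a bridge. -/
theorem exists_bridge_side (hG : IsFinite G) (f : Dart G) (hf : M.face.SameCycle f f.flip) :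
    ∃ S : Set α, ¬ (f.tail ∈ S ↔ f.head ∈ S) ∧
      ∀ d : Dart G, d.edge ≠ f.edge → (d.tail ∈ S ↔ d.head ∈ S) := by
  have hl := M.loopless
  have := hG.finite_dart
  have := hG.1.to_subtype
  have := hG.2.to_subtype
  have := Fintype.ofFinite (Dart G)
  have := Fintype.ofFinite V(G)
  have := Fintype.ofFinite E(G)
  let F := Quotient (Equiv.Perm.SameCycle.setoid M.face)
  have : Fintype F := Fintype.ofFinite F
  let K := ZMod 2
  have dart : ∀ e : E(G), ∃ d : Dart G, d.edge = e := fun e => by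
    obtain ⟨x, y, h⟩ := Graph.exists_isLink_of_mem_edgeSet e.2
    exact ⟨⟨e, x, y, h⟩, rfl⟩
  choose dart hdart using dart
  let fc : Dart G → F := fun d => Quotient.mk _ d
  let tl : Dart G → V(G) := fun d => ⟨d.tail, d.isLink.left_mem⟩
  let hd : Dart G → V(G) := fun d => ⟨d.head, d.isLink.right_mem⟩
  let ed : Dart G → E(G) := fun d => ⟨d.edge, d.isLink.edge_mem⟩
  have hfc : ∀ d, fc (M.face d) = fc d := fun d =>
    Quotient.sound (s := Equiv.Perm.SameCycle.setoid M.face)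
      ((Equiv.Perm.sameCycle_apply_left).mpr (Equiv.Perm.SameCycle.refl _ _))
  have hed : ∀ e d, ed d = e → d = dart e ∨ d = (dart e).flip := fun e d h =>
    Dart.eq_or_eq_flip (by rw [hdart, ← h])
  -- Over the field with two elements, δ is the coboundary map and B the incidence matrix of edges
  -- and faces, where an edge with the same face on both sides counts 1 + 1 = 0.
  let δ : (V(G) → K) →ₗ[K] (E(G) → K) :=
    LinearMap.pi fun e => LinearMap.proj (R := K) (φ := fun _ : V(G) => K) (tl (dart e)) +
      LinearMap.proj (R := K) (φ := fun _ : V(G) => K) (hd (dart e))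
  let B : Matrix E(G) F K := fun e Φ => (if fc (dart e) = Φ then 1 else 0) +
    (if fc (dart e).flip = Φ then 1 else 0)
  have hδ : ∀ x e, δ x e = x (tl (dart e)) + x (hd (dart e)) := fun x e => rfl
  have hBe : ∀ e Φ, B e Φ = (if fc (dart e) = Φ then 1 else 0) +
    (if fc (dart e).flip = Φ then 1 else 0) := fun _ _ => rfl
  have hB : ∀ y e, B.mulVecLin y e = y (fc (dart e)) + y (fc (dart e).flip) := by
    intro y e
    have hs : ∀ Ψ : F, (∑ Φ, if Ψ = Φ then y Φ else 0) = y Ψ := fun Ψ =>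
      (Finset.sum_ite_eq Finset.univ Ψ y).trans (if_pos (Finset.mem_univ Ψ))
    simp [Matrix.mulVec, dotProduct, hBe, add_mul, Finset.sum_add_distrib, hs]
  have add_eq : ∀ a b : K, a + b = 0 → a = b := by decide
  -- the kernels of `δ` and `B` consist of constant functions
  have kerδ : Module.finrank K (LinearMap.ker δ) ≤ 1 := by
    obtain ⟨a, ha⟩ := M.connected.1
    have hinj : Function.Injective ((LinearMap.proj (R := K) (φ := fun _ : V(G) => K) ⟨a, ha⟩).comp
        (LinearMap.ker δ).subtype) := by
      rw [← LinearMap.ker_eq_bot, LinearMap.ker_eq_bot']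
      rintro ⟨x, hx⟩ h0
      have hx0 : ∀ e, x (tl (dart e)) = x (hd (dart e)) := fun e =>
        add_eq _ _ (by rw [← hδ]; exact congrFun (LinearMap.mem_ker.mp hx) e)
      have hc := const_of_adj M.connected x (fun d => by
        rcases hed (ed d) d rfl with h | h
        · have := hx0 (ed d); rw [← h] at this; exact this
        · have := hx0 (ed d); rw [h]; exact this.symm)
      ext b
      exact (hc b ⟨a, ha⟩).trans h0
    simpa using LinearMap.finrank_le_finrank_of_injective hinj
  have kerB : Module.finrank K (LinearMap.ker B.mulVecLin) ≤ 1 := by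
    have hinj : Function.Injective ((LinearMap.proj (R := K) (φ := fun _ : F => K) (fc f)).comp
        (LinearMap.ker B.mulVecLin).subtype) := by
      rw [← LinearMap.ker_eq_bot, LinearMap.ker_eq_bot']
      rintro ⟨y, hy⟩ h0
      have hy0 : ∀ e, y (fc (dart e)) = y (fc (dart e).flip) := fun e =>
        add_eq _ _ (by rw [← hB]; exact congrFun (LinearMap.mem_ker.mp hy) e)
      have hc := M.const_of_invariant (fun d => y (fc d)) (fun d => by simp only [hfc])
        (fun d => by
          rcases hed (ed d) d rfl with h | h
          · rw [h]; exact (hy0 _).symm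
          · rw [h]; exact hy0 _)
      ext Φ
      obtain ⟨d, rfl⟩ := Quotient.exists_rep Φ
      exact (hc d f).trans h0
    simpa using LinearMap.finrank_le_finrank_of_injective hinj
  -- Along a closed boundary walk each vertex occurs as often as a tail as it does as a head, so the
  -- values of a coboundary cancel modulo 2.
  have range_le : LinearMap.range δ ≤ LinearMap.ker B.transpose.mulVecLin := by
    rintro _ ⟨x, rfl⟩
    rw [LinearMap.mem_ker]
    ext Φ
    have hsum : ∀ g : Dart G → K, ∑ d, g d = ∑ e, (g (dart e) + g (dart e).flip) := by
      intro g
      rw [← Finset.sum_fiberwise (s := Finset.univ) (g := ed)]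
      refine Finset.sum_congr rfl fun e _ => ?_
      have : Finset.univ.filter (fun d => ed d = e) = {dart e, (dart e).flip} := by
        ext d
        simp only [Finset.mem_filter, Finset.mem_univ, true_and, Finset.mem_insert,
          Finset.mem_singleton]
        refine ⟨hed e d, ?_⟩
        rintro (rfl | rfl) <;> exact Subtype.ext (hdart e)
      rw [this, Finset.sum_pair (Dart.flip_ne _).symm]
    have h1 : B.transpose.mulVecLin (δ x) Φ =
        ∑ d, (if fc d = Φ then (1 : K) else 0) * (x (tl d) + x (hd d)) := by
      rw [hsum]
      simp only [Matrix.mulVecLin_apply, Matrix.mulVec, dotProduct, Matrix.transpose_apply, hδ, hBe]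
      refine Finset.sum_congr rfl fun e _ => ?_
      have e1 : tl (dart e).flip = hd (dart e) := rfl
      have e2 : hd (dart e).flip = tl (dart e) := rfl
      rw [e1, e2]
      ring
    rw [h1]
    simp only [mul_add, Finset.sum_add_distrib, Pi.zero_apply]
    rw [← Equiv.sum_comp M.face (fun d => (if fc d = Φ then (1 : K) else 0) * x (tl d))]
    have h2 : ∀ d, tl (M.face d) = hd d := fun d => Subtype.ext (M.tail_face d)
    simp only [hfc, h2]
    exact CharTwo.add_self_eq_zero _
  have heuler : Fintype.card V(G) + Fintype.card F = Fintype.card E(G) + 2 := by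
    have hF : Nat.card F = Fintype.card F := Nat.card_eq_fintype_card
    have := M.euler
    change _ + Nat.card F = _ at this
    rwa [hF, ← Nat.card_coe_set_eq, ← Nat.card_coe_set_eq, Nat.card_eq_fintype_card,
      Nat.card_eq_fintype_card] at this
  have d1 := LinearMap.finrank_range_add_finrank_ker δ
  have d2 := LinearMap.finrank_range_add_finrank_ker B.mulVecLin
  have d3 := LinearMap.finrank_range_add_finrank_ker B.transpose.mulVecLin
  have d4 : Module.finrank K (LinearMap.range B.transpose.mulVecLin) =
    Module.finrank K (LinearMap.range B.mulVecLin) := B.rank_transpose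
  simp only [Module.finrank_fintype_fun_eq_card] at d1 d2 d3
  -- The range of δ has dimension at least |V| - 1, and the kernel of the transpose of B at most |E|
  -- - |F| + 1. By Euler's formula these bounds agree, so the two spaces coincide.
  have heq := Submodule.eq_of_le_of_finrank_le range_le (by omega)
  -- The row of f in B vanishes, so the indicator of f is a coboundary. It is the coboundary of a
  -- vertex set that f alone leaves.
  have hmem : Pi.single (ed f) (1 : K) ∈ LinearMap.ker B.transpose.mulVecLin := by
    rw [LinearMap.mem_ker]
    ext Φ
    have h1 : fc (dart (ed f)) = fc (dart (ed f)).flip := by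
      have : fc f = fc f.flip := Quotient.sound (s := Equiv.Perm.SameCycle.setoid M.face) hf
      rcases hed (ed f) f rfl with h | h
      · rw [← h]; exact this
      · rw [h] at this
        exact this.symm
    rw [Matrix.mulVecLin_apply, Matrix.mulVec_single_one]
    simp only [Matrix.col_apply, Matrix.transpose_apply, hBe, ← h1]
    exact CharTwo.add_self_eq_zero _
  rw [← heq] at hmem
  obtain ⟨x, hx⟩ := hmem
  have hx' : ∀ d : Dart G, x (tl d) + x (hd d) = (Pi.single (ed f) (1 : K) : E(G) → K) (ed d) := by
    intro d
    rw [← hx, hδ]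
    rcases hed (ed d) d rfl with h | h
    · rw [← h]
    · have a1 : tl d = hd (dart (ed d)) := Subtype.ext (congrArg Dart.tail h)
      have a2 : hd d = tl (dart (ed d)) := Subtype.ext (congrArg Dart.head h)
      rw [a1, a2, add_comm]
  refine ⟨{a | ∃ h : a ∈ V(G), x ⟨a, h⟩ = 1}, ?_, ?_⟩
  · have := hx' f
    rw [Pi.single_eq_same] at this
    have key : ∀ a b : K, a + b = 1 → ¬ (a = 1 ↔ b = 1) := by decide
    have := key _ _ this
    simpa [f.isLink.left_mem, f.isLink.right_mem] using this
  · intro d hd'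
    have := hx' d
    rw [Pi.single_eq_of_ne (fun h => hd' (congrArg Subtype.val h))] at this
    have := add_eq _ _ this
    simp only [tl, hd] at this
    simp [d.isLink.left_mem, d.isLink.right_mem, this]

/-- In a 2-connected plane graph, the two sides of an edge are in different faces. -/
theorem not_sameCycle_flip (hG : IsFinite G) (h2 : TwoConnected G) (f : Dart G) :
    ¬ M.face.SameCycle f f.flip := by
  intro hf
  obtain ⟨S, hS, hd⟩ := M.exists_bridge_side hG f hf
  obtain ⟨hl, hcard, hconn, hcut⟩ := h2
  -- Deleting an end c of f deletes f, so the remaining connected graph stays on one side of S.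
  -- Applying this to both ends, with a third vertex w, puts the ends of f on the same side.
  have key : ∀ c w t, c ∈ V(G) → w ∈ V(G) → t ∈ V(G) → (f.tail = c ∨ f.head = c) → w ≠ c → t ≠ c →
      (w ∈ S ↔ t ∈ S) := by
    intro c w t hc hw ht hfc hwc htc
    have h1 := (hcut c hc).2 w (by simp [hw, hwc]) t (by simp [ht, htc])
    clear ht htc
    induction h1 with
    | refl => rfl
    | tail _ hab ih =>
      obtain ⟨e, he⟩ := hab
      rw [Graph.deleteVerts_isLink] at he
      obtain ⟨he, ha, hb⟩ := he
      refine Iff.trans ih (hd ⟨e, _, _, he⟩ fun hef => ?_)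
      have hef : e = f.edge := hef
      have h3 := he
      rw [hef] at h3
      rcases f.isLink.eq_and_eq_or_eq_and_eq h3 with h4 | h4 <;>
        rcases hfc with h5 | h5 <;> simp_all
  obtain ⟨w, hw, hwn⟩ : ∃ w ∈ V(G), w ∉ ({f.tail, f.head} : Set α) := by
    by_contra! hall
    have h3 := Set.ncard_le_ncard (show V(G) ⊆ {f.tail, f.head} from hall)
    have h4 := Set.ncard_insert_le f.tail {f.head}
    rw [Set.ncard_singleton] at h4
    omega
  simp only [Set.mem_insert_iff, Set.mem_singleton_iff, not_or] at hwn
  have hne : f.tail ≠ f.head := f.tail_ne_head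
  have k1 := key f.tail w f.head f.isLink.left_mem hw f.isLink.right_mem (Or.inl rfl) hwn.1 hne.symm
  have k2 := key f.head w f.tail f.isLink.right_mem hw f.isLink.left_mem (Or.inr rfl) hwn.2 hne
  exact hS (k2.symm.trans k1)

end PlaneEmbedding
theorem incidenceSet_eq_image (x : α) :
    G.incidenceSet x = Dart.edge '' {d : Dart G | d.tail = x} := by
  ext e
  constructor
  · rintro ⟨y, hy⟩
    exact ⟨⟨e, x, y, hy⟩, rfl, rfl⟩
  · rintro ⟨d, rfl, rfl⟩
    exact ⟨d.head, d.isLink⟩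

theorem degree_eq_ncard_incidenceSet [hl : G.Loopless] (x : α) :
    degree G x = (G.incidenceSet x).ncard := by
  have : G.loopSet x = ∅ := Set.eq_empty_of_forall_notMem fun e he => hl.not_isLoopAt e x he
  rw [degree, this, Set.ncard_empty, add_zero]

theorem degree_eq_ncard_darts [G.Loopless] (x : α) :
    degree G x = {d : Dart G | d.tail = x}.ncard := by
  rw [degree_eq_ncard_incidenceSet, incidenceSet_eq_image, Set.InjOn.ncard_image]
  intro d hd d' hd' h
  rcases Dart.eq_or_eq_flip h with rfl | rfl
  · rfl
  · exact absurd (hd.trans hd'.symm) (d'.tail_ne_head).symm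

/-- The darts `c₀, c₁, c₂, c₃` form a closed walk through four distinct vertices. -/
structure IsSquare (c₀ c₁ c₂ c₃ : Dart G) : Prop where
  h01 : c₁.tail = c₀.head
  h12 : c₂.tail = c₁.head
  h23 : c₃.tail = c₂.head
  h30 : c₀.tail = c₃.head
  n01 : c₀.tail ≠ c₁.tail
  n02 : c₀.tail ≠ c₂.tail
  n03 : c₀.tail ≠ c₃.tail
  n12 : c₁.tail ≠ c₂.tail
  n13 : c₁.tail ≠ c₃.tail
  n23 : c₂.tail ≠ c₃.tail

namespace IsSquare

variable {c₀ c₁ c₂ c₃ : Dart G}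

theorem rotate (h : IsSquare c₀ c₁ c₂ c₃) : IsSquare c₁ c₂ c₃ c₀ :=
  ⟨h.h12, h.h23, h.h30, h.h01, h.n12, h.n13, h.n01.symm, h.n23, h.n02.symm, h.n03.symm⟩

theorem reverse (h : IsSquare c₀ c₁ c₂ c₃) : IsSquare c₁.flip c₀.flip c₃.flip c₂.flip := by
  constructor <;> simp only [Dart.flip_tail, Dart.flip_head, ← h.h01, ← h.h12, ← h.h23, ← h.h30]
  exacts [h.n12.symm, h.n02.symm, h.n23, h.n01.symm, h.n13, h.n03]

theorem ne_flip (h : IsSquare c₀ c₁ c₂ c₃) : c₁ ≠ c₀.flip := fun he => by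
  have := congrArg Dart.head he
  rw [Dart.flip_head, ← h.h12] at this
  exact h.n02 this.symm

end IsSquare

/-! ### Boundary walks along 4-cycles at vertices of degree two and three. -/

namespace PlaneEmbedding

variable (M : PlaneEmbedding G)

theorem next_ne {d d' : Dart G} (ht : d.tail = d'.tail) (hne : d ≠ d') : M.next d ≠ d :=
  fun h => hne ((M.sameCycle_of_tail_eq d d' ht).eq_of_left h)

theorem face_eq_of_degree_two {c c' : Dart G} (hdeg : degree G c.head = 2)
    (ht : c'.tail = c.head) (hne : c' ≠ c.flip) : M.face c = c' := by
  have := M.loopless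
  rw [degree_eq_ncard_darts] at hdeg
  obtain ⟨a, b, hab, hs⟩ := Set.ncard_eq_two.mp hdeg
  have hmem : ∀ d : Dart G, d.tail = c.head ↔ d = a ∨ d = b := fun d => Set.ext_iff.mp hs d
  have h1 := M.next_ne (d := c.flip) (d' := c') ht.symm hne.symm
  have h2 := (hmem _).mp (M.tail_face c)
  have h3 := (hmem c').mp ht
  have h4 := (hmem c.flip).mp rfl
  rw [face_apply] at h2 ⊢
  grind

/-- At a vertex of degree at most three, a boundary walk that arrives along `c` either continues with
`c'`, or there is a third edge, and the boundary walk that arrives along `c'` continues along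
`c`. -/
theorem face_eq_or {c c' : Dart G} (hdeg : degree G c.head = 2 ∨ degree G c.head = 3)
    (ht : c'.tail = c.head) (hne : c' ≠ c.flip) :
    M.face c = c' ∨ M.face (M.face c).flip = c' ∧ M.face c'.flip = c.flip := by
  rcases hdeg with hdeg | hdeg
  · exact Or.inl (M.face_eq_of_degree_two hdeg ht hne)
  have := M.loopless
  rw [degree_eq_ncard_darts] at hdeg
  obtain ⟨a, b, d, hab, had, hbd, hs⟩ := Set.ncard_eq_three.mp hdeg
  have hmem : ∀ g : Dart G, g.tail = c.head ↔ g = a ∨ g = b ∨ g = d := fun d => Set.ext_iff.mp hs d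
  have hc := (hmem c.flip).mp rfl
  have hc' := (hmem c').mp ht
  have hta := (hmem a).mpr (by simp)
  have htb := (hmem b).mpr (by simp)
  have htd := (hmem d).mpr (by simp)
  have na := M.next_ne (hta.trans htb.symm) hab
  have nb := M.next_ne (htb.trans hta.symm) hab.symm
  have nd := M.next_ne (htd.trans hta.symm) had.symm
  have ma := (hmem _).mp ((M.tail_next a).trans hta)
  have mb := (hmem _).mp ((M.tail_next b).trans htb)
  have md := (hmem _).mp ((M.tail_next d).trans htd)
  have iab := M.next.injective.ne hab
  have iad := M.next.injective.ne had
  have ibd := M.next.injective.ne hbd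
  simp only [face_apply, Dart.flip_flip]
  grind

theorem mem_of_sameCycle (hG : IsFinite G) {S : Set (Dart G)} (hS : ∀ d ∈ S, M.face d ∈ S)
    {d d' : Dart G} (hd : d ∈ S) (h : M.face.SameCycle d d') : d' ∈ S := by
  have := hG.finite_dart
  obtain ⟨n, rfl⟩ := h.exists_nat_pow_eq
  clear h
  induction n with
  | zero => exact hd
  | succ n ih => rw [pow_succ', Equiv.Perm.mul_apply]; exact hS _ ih

theorem sameCycle_face {o d : Dart G} (h : M.face.SameCycle o d) : M.face.SameCycle o (M.face d) :=
  Equiv.Perm.sameCycle_apply_right.mpr h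

theorem sameCycle_of_face {o d : Dart G} (h : M.face.SameCycle o (M.face d)) :
    M.face.SameCycle o d := Equiv.Perm.sameCycle_apply_right.mp h

variable {M}

/-- If a boundary walk uses two consecutive darts, which meet in a vertex of degree at most three,
then it uses one immediately after the other. -/
theorem face_eq_of_mem (hG : IsFinite G) (h2 : TwoConnected G) {o c c' : Dart G}
    (hc : M.face.SameCycle o c) (hc' : M.face.SameCycle o c')
    (hdeg : degree G c.head = 2 ∨ degree G c.head = 3)
    (ht : c'.tail = c.head) (hne : c' ≠ c.flip) : M.face c = c' := by
  rcases M.face_eq_or hdeg ht hne with h | ⟨h, -⟩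
  · exact h
  -- In the other case the third edge at the vertex follows c, and its reverse precedes c', so the
  -- face of o is on both of its sides.
  · exfalso
    have h3 : M.face.SameCycle o (M.face c).flip := M.sameCycle_of_face (by rwa [h])
    exact M.not_sameCycle_flip hG h2 _ ((M.sameCycle_face hc).symm.trans h3)

theorem sameCycle_iff_of_orbit (hG : IsFinite G) {r₀ r₁ r₂ r₃ : Dart G} (h0 : M.face r₀ = r₁)
    (h1 : M.face r₁ = r₂) (h2 : M.face r₂ = r₃) (h3 : M.face r₃ = r₀) (d : Dart G) :
    M.face.SameCycle r₀ d ↔ d = r₀ ∨ d = r₁ ∨ d = r₂ ∨ d = r₃ := by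
  constructor
  · refine M.mem_of_sameCycle hG (S := {d | d = r₀ ∨ d = r₁ ∨ d = r₂ ∨ d = r₃}) ?_ (Or.inl rfl)
    rintro d (rfl | rfl | rfl | rfl) <;> simp [h0, h1, h2, h3]
  · have k1 : M.face.SameCycle r₀ r₁ := h0 ▸ M.sameCycle_face (Equiv.Perm.SameCycle.refl _ _)
    have k2 : M.face.SameCycle r₀ r₂ := h1 ▸ M.sameCycle_face k1
    have k3 : M.face.SameCycle r₀ r₃ := h2 ▸ M.sameCycle_face k2
    rintro (rfl | rfl | rfl | rfl)
    exacts [Equiv.Perm.SameCycle.refl _ _, k1, k2, k3]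

theorem faceLength_eq_four {r₀ r₁ r₂ r₃ : Dart G} (h0 : M.face r₀ = r₁)
    (h1 : M.face r₁ = r₂) (h2 : M.face r₂ = r₃) (h3 : M.face r₃ = r₀) (hne : r₂ ≠ r₀) :
    M.faceLength r₀ = 4 := by
  have hp : Function.IsPeriodicPt M.face 4 r₀ := by
    change M.face (M.face (M.face (M.face r₀))) = r₀
    rw [h0, h1, h2, h3]
  have hdvd : Function.minimalPeriod M.face r₀ ∣ 2 ^ 2 := hp.minimalPeriod_dvd
  obtain ⟨i, hi, hi'⟩ := (Nat.dvd_prime_pow Nat.prime_two).mp hdvd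
  have hnot : ¬ Function.minimalPeriod M.face r₀ ∣ 2 := fun hd => by
    have hp2 : Function.IsPeriodicPt M.face 2 r₀ :=
      (Function.isPeriodicPt_minimalPeriod M.face r₀).trans_dvd hd
    have : M.face (M.face r₀) = r₀ := hp2
    rw [h0, h1] at this
    exact hne this
  unfold faceLength
  rw [hi'] at hnot ⊢
  interval_cases i
  · exact absurd (by norm_num) hnot
  · exact absurd (by norm_num) hnot
  · norm_num

/-- The 4-cycle `c₀, c₁, c₂, c₃` bounds a face other than that of `o`. -/
def BoundsFace (M : PlaneEmbedding G) (o c₀ c₁ c₂ c₃ : Dart G) : Prop :=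
  ∃ r : Dart G, ¬ M.face.SameCycle o r ∧ M.faceLength r = 4 ∧
    M.faceVerts r = {c₀.tail, c₁.tail, c₂.tail, c₃.tail} ∧
    M.faceEdges r = {c₀.edge, c₁.edge, c₂.edge, c₃.edge}

section Square

variable {o c₀ c₁ c₂ c₃ : Dart G}

theorem BoundsFace.rotate (h : BoundsFace M o c₀ c₁ c₂ c₃) : BoundsFace M o c₁ c₂ c₃ c₀ := by
  obtain ⟨r, h1, h2, h3, h4⟩ := h
  refine ⟨r, h1, h2, h3.trans ?_, h4.trans ?_⟩ <;>
    · ext x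
      simp only [Set.mem_insert_iff, Set.mem_singleton_iff]
      tauto

/-- The face of `o` is not bounded by a 4-cycle if it has a vertex outside of it. -/
theorem false_of_straight (hG : IsFinite G)
    (hc : M.face.SameCycle o c₀) (hout : ∃ d, M.face.SameCycle o d ∧ d.tail ≠ c₀.tail ∧
      d.tail ≠ c₁.tail ∧ d.tail ≠ c₂.tail ∧ d.tail ≠ c₃.tail)
    (h0 : M.face c₀ = c₁) (h1 : M.face c₁ = c₂) (h2 : M.face c₂ = c₃) (h3 : M.face c₃ = c₀) :
    False := by
  obtain ⟨d, hd, n0, n1, n2, n3⟩ := hout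
  rcases (M.sameCycle_iff_of_orbit hG h0 h1 h2 h3 d).mp (hc.symm.trans hd) with rfl | rfl | rfl | rfl
  all_goals contradiction

/-- The face of o follows c₀, c₁, c₂. If it also followed one of the two remaining darts it would
close up to the 4-cycle, contrary to `hout`. So it turns off at both ends of c₃, the third edges
there lie on its side, and the reversed 4-cycle is a boundary walk. -/
theorem boundsFace_of_adjacent (hG : IsFinite G) (htc : TwoConnected G)
    (hsq : IsSquare c₀ c₁ c₂ c₃) (hdeg0 : degree G c₀.tail = 2 ∨ degree G c₀.tail = 3)
    (hdeg1 : degree G c₁.tail = 2) (hdeg2 : degree G c₂.tail = 2)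
    (hdeg3 : degree G c₃.tail = 2 ∨ degree G c₃.tail = 3) (hc0 : M.face.SameCycle o c₀)
    (hout : ∃ d, M.face.SameCycle o d ∧ d.tail ≠ c₀.tail ∧
      d.tail ≠ c₁.tail ∧ d.tail ≠ c₂.tail ∧ d.tail ≠ c₃.tail) : BoundsFace M o c₀ c₁ c₂ c₃ := by
  have hr := hsq.reverse
  have s1 : M.face c₀ = c₁ := M.face_eq_of_degree_two (hsq.h01 ▸ hdeg1) hsq.h01 hsq.ne_flip
  have s2 : M.face c₁ = c₂ :=
    M.face_eq_of_degree_two (hsq.h12 ▸ hdeg2) hsq.h12 hsq.rotate.ne_flip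
  have r1 : M.face c₁.flip = c₀.flip :=
    M.face_eq_of_degree_two hdeg1 hr.h01 hr.ne_flip
  have r2 : M.face c₂.flip = c₁.flip :=
    M.face_eq_of_degree_two hdeg2 hr.h30 hr.rotate.rotate.rotate.ne_flip
  have hc1 := M.sameCycle_face hc0
  rw [s1] at hc1
  have hc2 := M.sameCycle_face hc1
  rw [s2] at hc2
  have p3 := M.face_eq_or (c := c₂) (c' := c₃) (hsq.h23 ▸ hdeg3) hsq.h23
    hsq.rotate.rotate.ne_flip
  have p0 := M.face_eq_or (c := c₃) (c' := c₀) (hsq.h30 ▸ hdeg0) hsq.h30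
    hsq.rotate.rotate.rotate.ne_flip
  have r3 : M.face c₃.flip = c₂.flip := by
    rcases p3 with p3 | ⟨-, p3⟩
    · exfalso
      have hc3 := M.sameCycle_face hc2
      rw [p3] at hc3
      have s0 := face_eq_of_mem hG htc hc3 hc0 (hsq.h30 ▸ hdeg0) hsq.h30
        hsq.rotate.rotate.rotate.ne_flip
      exact false_of_straight hG hc0 hout s1 s2 p3 s0
    · exact p3
  have r0 : M.face c₀.flip = c₃.flip := by
    rcases p0 with p0 | ⟨-, p0⟩
    · exfalso
      have hc3 : M.face.SameCycle o c₃ := M.sameCycle_of_face (by rwa [p0])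
      have s3 := face_eq_of_mem hG htc hc2 hc3 (hsq.h23 ▸ hdeg3) hsq.h23
        hsq.rotate.rotate.ne_flip
      exact false_of_straight hG hc0 hout s1 s2 s3 p0
    · exact p0
  have hiff := M.sameCycle_iff_of_orbit hG r0 r3 r2 r1
  refine ⟨c₀.flip, fun h => M.not_sameCycle_flip hG htc _ (hc0.symm.trans h),
    faceLength_eq_four r0 r3 r2 r1 fun h => ?_, ?_, ?_⟩
  · have := congrArg Dart.head h
    exact hsq.n02 this.symm
  · have e0 : c₀.flip.tail = c₁.tail := hsq.h01.symm
    have e1 : c₁.flip.tail = c₂.tail := hsq.h12.symm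
    have e2 : c₂.flip.tail = c₃.tail := hsq.h23.symm
    have e3 : c₃.flip.tail = c₀.tail := hsq.h30.symm
    ext x
    simp only [Set.mem_insert_iff, Set.mem_singleton_iff]
    constructor
    · rintro ⟨d, hd, rfl⟩
      rcases (hiff d).mp hd with rfl | rfl | rfl | rfl
      exacts [Or.inr (Or.inl e0), Or.inl e3, Or.inr (Or.inr (Or.inr e2)),
        Or.inr (Or.inr (Or.inl e1))]
    · rintro (rfl | rfl | rfl | rfl)
      exacts [⟨_, (hiff c₃.flip).mpr (by simp), e3⟩, ⟨_, (hiff c₀.flip).mpr (by simp), e0⟩,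
        ⟨_, (hiff c₁.flip).mpr (by simp), e1⟩, ⟨_, (hiff c₂.flip).mpr (by simp), e2⟩]
  · ext x
    simp only [Set.mem_insert_iff, Set.mem_singleton_iff]
    constructor
    · rintro ⟨d, hd, rfl⟩
      rcases (hiff d).mp hd with rfl | rfl | rfl | rfl <;> simp
    · rintro (rfl | rfl | rfl | rfl)
      exacts [⟨_, (hiff c₀.flip).mpr (by simp), rfl⟩, ⟨_, (hiff c₁.flip).mpr (by simp), rfl⟩,
        ⟨_, (hiff c₂.flip).mpr (by simp), rfl⟩, ⟨_, (hiff c₃.flip).mpr (by simp), rfl⟩]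

theorem eq_or_eq_of_degree_two [G.Loopless] {c c' : Dart G} (hdeg : degree G c.head = 2)
    (ht : c'.tail = c.head) (hne : c' ≠ c.flip) {d : Dart G} (hd : d.tail = c.head) :
    d = c' ∨ d = c.flip := by
  rw [degree_eq_ncard_darts] at hdeg
  obtain ⟨a, b, hab, hs⟩ := Set.ncard_eq_two.mp hdeg
  have hmem : ∀ d : Dart G, d.tail = c.head ↔ d = a ∨ d = b := fun d => Set.ext_iff.mp hs d
  have h2 := (hmem d).mp hd
  have h3 := (hmem c').mp ht
  have h4 := (hmem c.flip).mp rfl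
  grind

/-- The face of o follows c₀, c₁ and reaches the opposite vertex of degree two along c₂ or along c₃
reversed. In the same direction it would be bounded by the 4-cycle; in the reverse direction the
vertex between c₁ and c₂ leads it to the second side of one of these edges. -/
theorem not_opposite (hG : IsFinite G) (htc : TwoConnected G)
    (hsq : IsSquare c₀ c₁ c₂ c₃) (hdeg0 : degree G c₀.tail = 2 ∨ degree G c₀.tail = 3)
    (hdeg1 : degree G c₁.tail = 2) (hdeg2 : degree G c₂.tail = 2 ∨ degree G c₂.tail = 3)
    (hdeg3 : degree G c₃.tail = 2) (hc0 : M.face.SameCycle o c₀)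
    (hz : ∃ d, M.face.SameCycle o d ∧ d.tail = c₃.tail)
    (hout : ∃ d, M.face.SameCycle o d ∧ d.tail ≠ c₀.tail ∧
      d.tail ≠ c₁.tail ∧ d.tail ≠ c₂.tail ∧ d.tail ≠ c₃.tail) : False := by
  have := M.loopless
  have hr := hsq.reverse
  have s1 : M.face c₀ = c₁ := M.face_eq_of_degree_two (hsq.h01 ▸ hdeg1) hsq.h01 hsq.ne_flip
  have s3 : M.face c₂ = c₃ :=
    M.face_eq_of_degree_two (hsq.h23 ▸ hdeg3) hsq.h23 hsq.rotate.rotate.ne_flip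
  have r3 : M.face c₃.flip = c₂.flip :=
    M.face_eq_of_degree_two hdeg3 hr.h23 hr.rotate.rotate.ne_flip
  have hc1 := M.sameCycle_face hc0
  rw [s1] at hc1
  obtain ⟨d, hd, hdt⟩ := hz
  rcases eq_or_eq_of_degree_two (hsq.h23 ▸ hdeg3) hsq.h23 hsq.rotate.rotate.ne_flip
    (hdt.trans hsq.h23) with rfl | rfl
  · have hc2 : M.face.SameCycle o c₂ := M.sameCycle_of_face (by rwa [s3])
    have s2 := face_eq_of_mem hG htc hc1 hc2 (hsq.h12 ▸ hdeg2) hsq.h12 hsq.rotate.ne_flip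
    have s0 := face_eq_of_mem hG htc hd hc0 (hsq.h30 ▸ hdeg0) hsq.h30
      hsq.rotate.rotate.rotate.ne_flip
    exact false_of_straight hG hc0 hout s1 s2 s3 s0
  · rcases M.face_eq_or (c := c₁) (c' := c₂) (hsq.h12 ▸ hdeg2) hsq.h12 hsq.rotate.ne_flip with
      p | ⟨-, p⟩
    · have := M.sameCycle_face hc1
      rw [p] at this
      exact M.not_sameCycle_flip hG htc _ (this.symm.trans hd)
    · have := M.sameCycle_face hd
      rw [p] at this
      exact M.not_sameCycle_flip hG htc _ (hc1.symm.trans this)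

/-- If two of the vertices of a 4-cycle have degree two and are on the boundary of the face of `o`,
and the others have degree three, then the 4-cycle bounds another face. -/
theorem boundsFace_of_square (hG : IsFinite G) (htc : TwoConnected G)
    (hsq : IsSquare c₀ c₁ c₂ c₃) (hdeg : ∀ x ∈ V(G), degree G x = 2 ∨ degree G x = 3)
    (hdeg1 : degree G c₁.tail = 2) (hz1 : ∃ d, M.face.SameCycle o d ∧ d.tail = c₁.tail)
    (hdeg' : ∃ d, M.face.SameCycle o d ∧ degree G d.tail = 2 ∧
      (d.tail = c₀.tail ∨ d.tail = c₂.tail ∨ d.tail = c₃.tail))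
    (hout : ∃ d, M.face.SameCycle o d ∧ d.tail ≠ c₀.tail ∧
      d.tail ≠ c₁.tail ∧ d.tail ≠ c₂.tail ∧ d.tail ≠ c₃.tail) : BoundsFace M o c₀ c₁ c₂ c₃ := by
  have := M.loopless
  -- The case in which the face of o passes the vertex of degree two in the direction of the square;
  -- the other direction is reduced to it by reversing the square.
  have key : ∀ {c₀ c₁ c₂ c₃ : Dart G}, IsSquare c₀ c₁ c₂ c₃ → degree G c₁.tail = 2 →
      M.face.SameCycle o c₁ → (∃ d, M.face.SameCycle o d ∧ degree G d.tail = 2 ∧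
      (d.tail = c₀.tail ∨ d.tail = c₂.tail ∨ d.tail = c₃.tail)) →
      (∃ d, M.face.SameCycle o d ∧ d.tail ≠ c₀.tail ∧
      d.tail ≠ c₁.tail ∧ d.tail ≠ c₂.tail ∧ d.tail ≠ c₃.tail) → BoundsFace M o c₀ c₁ c₂ c₃ := by
    intro c₀ c₁ c₂ c₃ hsq hdeg1 hc1 hdeg' hout
    have s1 : M.face c₀ = c₁ := M.face_eq_of_degree_two (hsq.h01 ▸ hdeg1) hsq.h01 hsq.ne_flip
    have hc0 : M.face.SameCycle o c₀ := M.sameCycle_of_face (by rwa [s1])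
    have d0 := hdeg _ c₀.isLink.left_mem
    have d2 := hdeg _ c₂.isLink.left_mem
    have d3 := hdeg _ c₃.isLink.left_mem
    obtain ⟨d, hd, hd2, h | h | h⟩ := hdeg'
    · rw [h] at hd2
      have s0 : M.face c₃ = c₀ :=
        M.face_eq_of_degree_two (hsq.h30 ▸ hd2) hsq.h30 hsq.rotate.rotate.rotate.ne_flip
      have hc3 : M.face.SameCycle o c₃ := M.sameCycle_of_face (by rwa [s0])
      obtain ⟨g, hg, n0, n1, n2, n3⟩ := hout
      exact (boundsFace_of_adjacent hG htc hsq.rotate.rotate.rotate d3 hd2 hdeg1 d2 hc3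
        ⟨g, hg, n3, n0, n1, n2⟩).rotate
    · rw [h] at hd2
      exact boundsFace_of_adjacent hG htc hsq d0 hdeg1 hd2 d3 hc0 hout
    · rw [h] at hd2
      exact (not_opposite hG htc hsq d0 hdeg1 d2 hd2 hc0 ⟨d, hd, h⟩ hout).elim
  obtain ⟨d, hd, hdt⟩ := hz1
  rcases eq_or_eq_of_degree_two (hsq.h01 ▸ hdeg1) hsq.h01 hsq.ne_flip (hdt.trans hsq.h01) with
    rfl | rfl
  · exact key hsq hdeg1 hd hdeg' hout
  · obtain ⟨r, h1, h2, h3, h4⟩ := key hsq.reverse (by rwa [Dart.flip_tail, ← hsq.h01]) hd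
      (by simp only [Dart.flip_tail, ← hsq.h01, ← hsq.h12, ← hsq.h23, ← hsq.h30]
          obtain ⟨d, a, b, c⟩ := hdeg'
          exact ⟨d, a, b, by tauto⟩)
      (by simp only [Dart.flip_tail, ← hsq.h01, ← hsq.h12, ← hsq.h23, ← hsq.h30]
          obtain ⟨d, a, n⟩ := hout
          exact ⟨d, a, by tauto⟩)
    refine ⟨r, h1, h2, h3.trans ?_, h4.trans ?_⟩
    · ext x
      simp only [Dart.flip_tail, ← hsq.h01, ← hsq.h12, ← hsq.h23, ← hsq.h30,
        Set.mem_insert_iff, Set.mem_singleton_iff]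
      tauto
    · ext x
      simp only [Dart.flip_edge, Set.mem_insert_iff, Set.mem_singleton_iff]
      tauto

end Square

end PlaneEmbedding
end Plane

/-! ### Canonical embeddings: the cut conditions, the outer circuit and the proof of the theorem. -/

section Canonical

variable {α β : Type*} {G : Graph α β} {σ : β → ℤˣ} {k : ℕ} {u v : β → α}

theorem mem_cut_iff (huv : ∀ e ∈ E(G), G.IsLink e (u e) (v e)) {e : β} (he : e ∈ E(G))
    (X : Set α) : e ∈ cut G X ↔ ¬ (u e ∈ X ↔ v e ∈ X) := by
  have hl := huv e he
  constructor
  · rintro ⟨x, y, h, hx, hy⟩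
    rcases hl.eq_and_eq_or_eq_and_eq h with ⟨h1, h2⟩ | ⟨h1, h2⟩
    · rw [h1, h2]; exact fun h => hy.2 (h.mp hx)
    · rw [h1, h2]; exact fun h => hy.2 (h.mpr hx)
  · intro h
    by_cases hu : u e ∈ X
    · exact ⟨u e, v e, hl, hu, hl.right_mem, fun hv => h ⟨fun _ => hv, fun _ => hu⟩⟩
    · refine ⟨v e, u e, hl.symm, ?_, hl.left_mem, hu⟩
      by_contra hv
      exact h ⟨fun h => absurd h hu, fun h => absurd h hv⟩

theorem cut_subset_edgeSet (G : Graph α β) (X : Set α) : cut G X ⊆ E(G) := by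
  rintro e ⟨x, y, h, -⟩
  exact h.edge_mem

theorem cut_compl (G : Graph α β) {X : Set α} (hX : X ⊆ V(G)) : cut G (V(G) \ X) = cut G X := by
  ext e
  constructor
  · rintro ⟨x, y, h, hx, hy⟩
    refine ⟨y, x, h.symm, ?_, hx⟩
    by_contra hyX
    exact hy.2 ⟨hy.1, hyX⟩
  · rintro ⟨x, y, h, hx, hy⟩
    exact ⟨y, x, h.symm, hy, hX hx, fun h => h.2 hx⟩

open Classical in
theorem ncard_negEdges_eq (E : Finset β) (hE : (E : Set β) = E(G)) (π : β → ℤˣ) :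
    ((negEdges G π).ncard : ℤ) = ∑ e ∈ E, if π e = -1 then 1 else 0 := by
  have : negEdges G π = (E.filter fun e => π e = -1 : Finset β) := by
    ext e
    simp [negEdges, ← hE]
  rw [this, Set.ncard_coe_finset, Finset.card_filter]
  push_cast
  rfl

open Classical in
/-- The change of the number of negative edges under switching. -/
theorem ncard_negEdges_switch (huv : ∀ e ∈ E(G), G.IsLink e (u e) (v e)) (E : Finset β)
    (hE : (E : Set β) = E(G)) {π : β → ℤˣ} (A : Finset α)
    (hπ : ∀ e ∈ E(G), π e = switch G A σ e) :
    ((negEdges G π).ncard : ℤ) = (negEdges G σ).ncard + ∑ e ∈ E, (σ e : ℤ) * crossing u v A e := by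
  rw [ncard_negEdges_eq E hE, ncard_negEdges_eq E hE, ← Finset.sum_add_distrib]
  refine Finset.sum_congr rfl fun e he => ?_
  have he' : e ∈ E(G) := hE ▸ he
  rw [hπ e he', switch, mem_cut_iff huv he', crossing]
  by_cases hc : u e ∈ A ↔ v e ∈ A
  · simp [hc]
  · rcases Int.units_eq_one_or (σ e) with h | h <;> simp [hc, h]

theorem isLink_posSubgraph {e : β} {x y : α} :
    (posSubgraph G σ).IsLink e x y ↔ G.IsLink e x y ∧ σ e = 1 := by
  rw [posSubgraph, Graph.deleteEdges_isLink]
  refine and_congr_right fun h => ?_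
  rcases Int.units_eq_one_or (σ e) with h1 | h1 <;> simp [negEdges, h1, h.edge_mem]

theorem inc_posSubgraph {e : β} {x : α} :
    (posSubgraph G σ).Inc e x ↔ G.Inc e x ∧ σ e = 1 := by
  simp [Graph.Inc, isLink_posSubgraph]

theorem IsFinite.posSubgraph (hG : IsFinite G) : IsFinite (posSubgraph G σ) :=
  ⟨hG.1, hG.2.subset (Graph.deleteEdges_le (F := negEdges G σ)).edgeSet_mono⟩

namespace CanonicalEmbedding

variable (𝓔 : CanonicalEmbedding G σ k)

/-- The first end of the `i`-th negative edge. -/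
def fst (i : Fin k) : Fin (2 * k) := ⟨i.1, by have := i.2; omega⟩

/-- The second end of the `i`-th negative edge. -/
def snd (i : Fin k) : Fin (2 * k) := ⟨i.1 + k, by have := i.2; omega⟩

theorem isLink_neg (i : Fin k) : G.IsLink (𝓔.negEdge i) (𝓔.z (fst i)) (𝓔.z (snd i)) :=
  𝓔.isLink_negEdge i

theorem exists_fst_or_snd (j : Fin (2 * k)) : ∃ i : Fin k, j = fst i ∨ j = snd i := by
  by_cases h : j.1 < k
  · exact ⟨⟨j.1, h⟩, Or.inl rfl⟩
  · exact ⟨⟨j.1 - k, by have := j.2; omega⟩, Or.inr (Fin.ext (by simp only [snd]; omega))⟩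

theorem fst_ne_snd (i j : Fin k) : fst i ≠ snd j := fun h => by
  have := congrArg Fin.val h
  simp only [fst, snd] at this
  have := i.2
  omega

theorem fst_inj {i j : Fin k} (h : fst i = fst j) : i = j :=
  Fin.ext (by simpa [fst] using congrArg Fin.val h)

theorem snd_inj {i j : Fin k} (h : snd i = snd j) : i = j :=
  Fin.ext (by simpa [snd] using congrArg Fin.val h)

theorem mem_negEdges {e : β} : e ∈ negEdges G σ ↔ ∃ i, 𝓔.negEdge i = e := by
  rw [← 𝓔.range_negEdge, Set.mem_range]

theorem inc_neg {i : Fin k} {x : α} :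
    G.Inc (𝓔.negEdge i) x ↔ x = 𝓔.z (fst i) ∨ x = 𝓔.z (snd i) := by
  constructor
  · exact fun h => h.eq_or_eq_of_isLink (𝓔.isLink_neg i)
  · rintro (rfl | rfl)
    · exact (𝓔.isLink_neg i).inc_left
    · exact (𝓔.isLink_neg i).inc_right

theorem loopless (𝓔 : CanonicalEmbedding G σ k) : G.Loopless := by
  refine ⟨fun e x h => ?_⟩
  rcases Int.units_eq_one_or (σ e) with h1 | h1
  · exact 𝓔.plane.loopless.not_isLoopAt e x (isLink_posSubgraph.mpr ⟨h, h1⟩)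
  · obtain ⟨i, rfl⟩ := 𝓔.mem_negEdges.mp ⟨h.edge_mem, h1⟩
    rcases (𝓔.isLink_neg i).eq_and_eq_or_eq_and_eq h with h2 | h2 <;>
      exact fst_ne_snd i i (𝓔.z_injective (h2.1.trans h2.2.symm))

theorem ncard_negEdges (𝓔 : CanonicalEmbedding G σ k) : (negEdges G σ).ncard = k := by
  rw [← 𝓔.range_negEdge, ← Set.image_univ, Set.ncard_image_of_injective _ 𝓔.negEdge_injective,
    Set.ncard_univ, Nat.card_eq_fintype_card, Fintype.card_fin]

/-- A vertex is incident with a single negative edge if it is one of the `z j`. -/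
theorem ncard_neg_at (j : Fin (2 * k)) : {e | G.Inc e (𝓔.z j) ∧ σ e = -1}.ncard = 1 := by
  obtain ⟨i, hi⟩ := exists_fst_or_snd j
  rw [Set.ncard_eq_one]
  refine ⟨𝓔.negEdge i, ?_⟩
  ext e
  simp only [Set.mem_singleton_iff]
  constructor
  · rintro ⟨h1, h2⟩
    obtain ⟨i', rfl⟩ := 𝓔.mem_negEdges.mp ⟨h1.edge_mem, h2⟩
    congr 1
    rcases 𝓔.inc_neg.mp h1 with h3 | h3 <;> have h3 := 𝓔.z_injective h3 <;>
      rcases hi with rfl | rfl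
    · exact (fst_inj h3).symm
    · exact absurd h3.symm (fst_ne_snd _ _)
    · exact absurd h3 (fst_ne_snd _ _)
    · exact (snd_inj h3).symm
  · rintro rfl
    have h1 : 𝓔.negEdge i ∈ negEdges G σ := 𝓔.mem_negEdges.mpr ⟨i, rfl⟩
    exact ⟨𝓔.inc_neg.mpr (hi.imp (fun h => by rw [h]) fun h => by rw [h]), h1.2⟩

theorem degree_posSubgraph (𝓔 : CanonicalEmbedding G σ k) {x : α} (hx : x ∈ V(G)) :
    degree (posSubgraph G σ) x = 2 ∨ degree (posSubgraph G σ) x = 3 := by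
  by_cases h : x ∈ Set.range 𝓔.z
  · obtain ⟨j, rfl⟩ := h
    exact Or.inl (𝓔.degree_z j)
  · exact Or.inr (𝓔.degree_eq_three x hx h)

theorem ncard_incidenceSet (𝓔 : CanonicalEmbedding G σ k) (hG : IsFinite G) {x : α} (hx : x ∈ V(G)) :
    (G.incidenceSet x).ncard = 3 := by
  have := 𝓔.plane.loopless
  have hd : degree (posSubgraph G σ) x = ((posSubgraph G σ).incidenceSet x).ncard :=
    degree_eq_ncard_incidenceSet x
  have hun : G.incidenceSet x = (posSubgraph G σ).incidenceSet x ∪ {e | G.Inc e x ∧ σ e = -1} := by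
    ext e
    simp only [Graph.mem_incidenceSet, Set.mem_union, inc_posSubgraph]
    rcases Int.units_eq_one_or (σ e) with h | h <;> simp [h]
  have hdisj : Disjoint ((posSubgraph G σ).incidenceSet x) {e | G.Inc e x ∧ σ e = -1} := by
    rw [Set.disjoint_left]
    intro e h1 h2
    have h3 := (inc_posSubgraph.mp h1).2
    rw [h2.2] at h3
    exact absurd h3 (by decide)
  have hfin : ∀ S ⊆ G.incidenceSet x, S.Finite := fun S hS =>
    hG.2.subset (hS.trans (G.incidenceSet_subset_edgeSet x))
  rw [hun, Set.ncard_union_eq hdisj (hfin _ fun e he => (inc_posSubgraph.mp he).1)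
    (hfin _ fun e he => he.1), ← hd]
  by_cases h : x ∈ Set.range 𝓔.z
  · obtain ⟨j, rfl⟩ := h
    rw [𝓔.degree_z, 𝓔.ncard_neg_at]
  · have : {e | G.Inc e x ∧ σ e = -1} = ∅ := by
      refine Set.eq_empty_of_forall_notMem fun e he => ?_
      obtain ⟨i, rfl⟩ := 𝓔.mem_negEdges.mp ⟨he.1.edge_mem, he.2⟩
      rcases 𝓔.inc_neg.mp he.1 with rfl | rfl <;> exact h ⟨_, rfl⟩
    rw [this, 𝓔.degree_eq_three x hx h, Set.ncard_empty]

open Classical in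
-- Switching at Y changes the number of negative edges by the signed size of the cut of Y.
-- Minimality of k makes it nonnegative, and an optimal switching of G without f provides the
-- balanced cut through f.
theorem cubicCritical (𝓔 : CanonicalEmbedding G σ k) (hG : IsFinite G) (hcrit : IsCritical G σ k)
    (huv : ∀ e ∈ E(G), G.IsLink e (u e) (v e)) :
    CubicCritical hG.1.toFinset hG.2.toFinset u v (fun e => (σ e : ℤ)) := by
  have hl := 𝓔.loopless
  have nonneg : ∀ Y : Finset α, 0 ≤ ∑ e ∈ hG.2.toFinset, (σ e : ℤ) * crossing u v Y e := by
    intro Y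
    -- `SwitchEquiv` admits only subsets of V(G); restricting Y to V(G) does not change which edges
    -- cross.
    let A := Y.filter (· ∈ V(G))
    have hcr : ∀ e ∈ hG.2.toFinset, crossing u v A e = crossing u v Y e := by
      intro e he
      rw [Set.Finite.mem_toFinset] at he
      simp [crossing, A, (huv e he).left_mem, (huv e he).right_mem]
    have h1 := ncard_negEdges_switch (σ := σ) huv hG.2.toFinset (by simp) A (fun e _ => rfl)
    have h2 : frustrationIndex G σ ≤ (negEdges G (switch G A σ)).ncard :=
      Nat.sInf_le ⟨_, ⟨A, by intro x hx; simp only [A, Finset.coe_filter] at hx; exact hx.2,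
        fun e _ => rfl⟩, rfl⟩
    rw [hcrit.1] at h2
    rw [𝓔.ncard_negEdges, Finset.sum_congr rfl fun e he => by rw [hcr e he]] at h1
    omega
  refine ⟨fun e he => ?_, fun e he => ?_, fun x hx => ?_, fun e _ => ?_, nonneg, fun f hf hpos => ?_⟩
  · rw [Set.Finite.mem_toFinset] at he ⊢
    exact (huv e he).left_mem
  · rw [Set.Finite.mem_toFinset] at he ⊢
    exact (huv e he).right_mem
  · rw [Set.Finite.mem_toFinset] at hx
    have h1 := 𝓔.ncard_incidenceSet hG hx
    have h2 : G.incidenceSet x =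
        (hG.2.toFinset.filter fun e => u e = x ∨ v e = x : Finset β) := by
      ext e
      simp only [Graph.mem_incidenceSet, Finset.coe_filter, Set.Finite.mem_toFinset]
      constructor
      · intro h
        exact ⟨h.edge_mem, (h.eq_or_eq_of_isLink (huv e h.edge_mem)).imp Eq.symm Eq.symm⟩
      · rintro ⟨he, rfl | rfl⟩
        · exact (huv e he).inc_left
        · exact (huv e he).inc_right
    rw [h2, Set.ncard_coe_finset, Finset.card_filter] at h1
    rw [← Nat.cast_inj (R := ℤ)] at h1
    push_cast at h1
    rw [← h1]
    refine Finset.sum_congr rfl fun e he => ?_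
    rw [Set.Finite.mem_toFinset] at he
    have hne := (huv e he).ne
    by_cases h3 : u e = x <;> by_cases h4 : v e = x <;> simp [h3, h4]
    exact hne (h3.trans h4.symm)
  · rcases Int.units_eq_one_or (σ e) with h | h <;> simp [h]
  · rw [Set.Finite.mem_toFinset] at hf
    have hσ : σ f = 1 := Units.ext hpos
    let H := G.deleteEdges {f}
    have hcf : frustrationIndex H σ + 1 = k := hcrit.2 f hf
    have hmem : frustrationIndex H σ ∈
        {n | ∃ π, SwitchEquiv H σ π ∧ (negEdges H π).ncard = n} :=
      Nat.sInf_mem ⟨_, switch H ∅ σ, ⟨∅, Set.empty_subset _, fun e _ => rfl⟩, rfl⟩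
    obtain ⟨π, ⟨X, hX, hπ⟩, hcard⟩ := hmem
    have hXf : X.Finite := hG.1.subset hX
    have huvH : ∀ e ∈ E(H), H.IsLink e (u e) (v e) := fun e he =>
      (Graph.deleteEdges_isLink ..).mpr ⟨huv e he.1, he.2⟩
    have hneg : negEdges H σ = negEdges G σ := by
      ext e
      constructor
      · exact fun h => ⟨h.1.1, h.2⟩
      · refine fun h => ⟨⟨h.1, ?_⟩, h.2⟩
        rintro rfl
        have := hσ.symm.trans h.2
        exact absurd this (by decide)
    have h1 := ncard_negEdges_switch (σ := σ) huvH (hG.2.toFinset.erase f)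
      (by ext e; simp [H, and_comm]) hXf.toFinset (π := π) (by simpa using hπ)
    rw [hneg, 𝓔.ncard_negEdges] at h1
    have h2 := nonneg hXf.toFinset
    have h3 := Finset.add_sum_erase hG.2.toFinset
      (fun e => (σ e : ℤ) * crossing u v hXf.toFinset e) ((Set.Finite.mem_toFinset _).mpr hf)
    simp only [hpos, one_mul] at h3
    have h4 : crossing u v hXf.toFinset f = 0 ∨ crossing u v hXf.toFinset f = 1 := by
      unfold crossing; split_ifs <;> simp
    -- Without f the signed size of the cut is (k - 1) - k = -1, and with f it is nonnegative. So f
    -- crosses, and the total is 0.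
    exact ⟨hXf.toFinset, by omega, by omega⟩

/-- The boundary walk of the outer face. -/
def walk (n : ℕ) : Dart (posSubgraph G σ) := (𝓔.plane.face ^ n) 𝓔.outer

theorem sameCycle_walk (n : ℕ) : 𝓔.plane.face.SameCycle 𝓔.outer (𝓔.walk n) :=
  Equiv.Perm.sameCycle_pow_right.mpr (Equiv.Perm.SameCycle.refl _ _)

theorem tail_walk_succ (n : ℕ) : (𝓔.walk (n + 1)).tail = (𝓔.walk n).head := by
  rw [walk, pow_succ', Equiv.Perm.mul_apply, PlaneEmbedding.tail_face]
  rfl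

theorem exists_outer (j : Fin (2 * k)) :
    ∃ d, 𝓔.plane.face.SameCycle 𝓔.outer d ∧ d.tail = 𝓔.z j :=
  ⟨_, 𝓔.sameCycle_walk _, 𝓔.tail_pos j⟩

/-- The boundary walk of the outer face uses each edge at most once. -/
theorem edge_walk_injOn (hG : IsFinite G) {m n : ℕ} (hm : m < 𝓔.plane.faceLength 𝓔.outer)
    (hn : n < 𝓔.plane.faceLength 𝓔.outer) (h : (𝓔.walk m).edge = (𝓔.walk n).edge) : m = n := by
  rcases Dart.eq_or_eq_flip h with h | h
  · simp only [walk, ← Equiv.Perm.iterate_eq_pow] at h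
    exact Function.iterate_injOn_Iio_minimalPeriod hm hn h
  · refine (𝓔.plane.not_sameCycle_flip hG.posSubgraph 𝓔.twoConnected (𝓔.walk n) ?_).elim
    rw [← h]
    exact (𝓔.sameCycle_walk n).symm.trans (𝓔.sameCycle_walk m)

theorem exists_crossing (S : Set α) {a b : ℕ} (hab : a ≤ b)
    (h : ¬ ((𝓔.walk a).tail ∈ S ↔ (𝓔.walk b).tail ∈ S)) :
    ∃ n, a ≤ n ∧ n < b ∧ (𝓔.walk n).edge ∈ cut G S ∩ posEdges G σ := by
  induction b, hab using Nat.le_induction with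
  | base => exact absurd Iff.rfl h
  | succ b hab ih =>
    by_cases h1 : (𝓔.walk a).tail ∈ S ↔ (𝓔.walk b).tail ∈ S
    · refine ⟨b, hab, b.lt_succ_self, ?_⟩
      rw [h1, tail_walk_succ] at h
      obtain ⟨hl, hs⟩ := isLink_posSubgraph.mp (𝓔.walk b).isLink
      refine ⟨?_, hl.edge_mem, hs⟩
      by_cases h2 : (𝓔.walk b).tail ∈ S
      · exact ⟨_, _, hl, h2, hl.right_mem, fun h3 => h ⟨fun _ => h3, fun _ => h2⟩⟩
      · refine ⟨_, _, hl.symm, ?_, hl.left_mem, h2⟩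
        by_contra h3
        exact h ⟨fun h => absurd h h2, fun h => absurd h h3⟩
    · obtain ⟨n, h2, h3, h4⟩ := ih h1
      exact ⟨n, h2, h3.trans b.lt_succ_self, h4⟩

/-- A cut with two positive edges does not have negative edges on both of its sides. -/
theorem not_both_sides (𝓔 : CanonicalEmbedding G σ k) (hG : IsFinite G) {S : Set α}
    (hS : (cut G S ∩ posEdges G σ).encard = 2) (i j : Fin k)
    (hi : 𝓔.z (fst i) ∈ S ∧ 𝓔.z (snd i) ∈ S) (hj : 𝓔.z (fst j) ∉ S ∧ 𝓔.z (snd j) ∉ S) : False := by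
  -- If membership in S changes at each step between four vertices in order on C, then the three
  -- disjoint arcs between them contain three distinct positive cut edges, one too many.
  have main : ∀ a b c d : Fin (2 * k), a < b → b < c → c < d →
      ¬ (𝓔.z a ∈ S ↔ 𝓔.z b ∈ S) → ¬ (𝓔.z b ∈ S ↔ 𝓔.z c ∈ S) → ¬ (𝓔.z c ∈ S ↔ 𝓔.z d ∈ S) →
      False := by
    intro a b c d hab hbc hcd h1 h2 h3
    simp only [← 𝓔.tail_pos] at h1 h2 h3
    have l1 := 𝓔.pos_strictMono hab
    have l2 := 𝓔.pos_strictMono hbc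
    have l3 := 𝓔.pos_strictMono hcd
    obtain ⟨n₁, a1, b1, c1⟩ := 𝓔.exists_crossing S l1.le h1
    obtain ⟨n₂, a2, b2, c2⟩ := 𝓔.exists_crossing S l2.le h2
    obtain ⟨n₃, a3, b3, c3⟩ := 𝓔.exists_crossing S l3.le h3
    have hd := 𝓔.pos_lt d
    have e12 : (𝓔.walk n₁).edge ≠ (𝓔.walk n₂).edge := fun h => by
      have := 𝓔.edge_walk_injOn hG (by omega) (by omega) h
      omega
    have e13 : (𝓔.walk n₁).edge ≠ (𝓔.walk n₃).edge := fun h => by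
      have := 𝓔.edge_walk_injOn hG (by omega) (by omega) h
      omega
    have e23 : (𝓔.walk n₂).edge ≠ (𝓔.walk n₃).edge := fun h => by
      have := 𝓔.edge_walk_injOn hG (by omega) (by omega) h
      omega
    obtain ⟨x, y, -, hxy⟩ := Set.encard_eq_two.mp hS
    rw [hxy] at c1 c2 c3
    simp only [Set.mem_insert_iff, Set.mem_singleton_iff] at c1 c2 c3
    grind
  have i2 := i.2
  have j2 := j.2
  -- For i < j one has i < j < i + k < j + k, so the ends of the two negative edges alternate on C.
  rcases lt_trichotomy i j with h | rfl | h
  · exact main (fst i) (fst j) (snd i) (snd j) h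
      (by rw [Fin.lt_def]; simp only [fst, snd]; omega)
      (by rw [Fin.lt_def]; simp only [snd]; rw [Fin.lt_def] at h; omega)
      (by tauto) (by tauto) (by tauto)
  · exact hj.1 hi.1
  · exact main (fst j) (fst i) (snd j) (snd i) h
      (by rw [Fin.lt_def]; simp only [fst, snd]; omega)
      (by rw [Fin.lt_def]; simp only [snd]; rw [Fin.lt_def] at h; omega)
      (by tauto) (by tauto) (by tauto)

end CanonicalEmbedding
/-- One of the two sides of a `(2, 2)`-cut has only positive inner edges. -/
theorem CanonicalEmbedding.exists_positive_side (𝓔 : CanonicalEmbedding G σ k) (hG : IsFinite G)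
    {Y : Set α} (hY : Y ⊆ V(G)) (hcut : IsCutOfType G σ 2 2 Y) :
    ∃ X ⊆ V(G), cut G X = cut G Y ∧ ∀ e x y, G.IsLink e x y → x ∈ X → y ∈ X → σ e = 1 := by
  have neg : ∀ S : Set α, (∀ i, ¬ (𝓔.z (fst i) ∈ S ∧ 𝓔.z (snd i) ∈ S)) →
      ∀ e x y, G.IsLink e x y → x ∈ S → y ∈ S → σ e = 1 := by
    intro S hS e x y h hx hy
    rcases Int.units_eq_one_or (σ e) with h1 | h1
    · exact h1
    · obtain ⟨i, rfl⟩ := 𝓔.mem_negEdges.mp ⟨h.edge_mem, h1⟩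
      exfalso
      rcases (𝓔.isLink_neg i).eq_and_eq_or_eq_and_eq h with ⟨h2, h3⟩ | ⟨h2, h3⟩
      · exact hS i ⟨h2 ▸ hx, h3 ▸ hy⟩
      · exact hS i ⟨h2 ▸ hy, h3 ▸ hx⟩
  by_cases hin : ∃ i, 𝓔.z (fst i) ∈ Y ∧ 𝓔.z (snd i) ∈ Y
  · obtain ⟨i, hi⟩ := hin
    refine ⟨V(G) \ Y, Set.sdiff_subset, cut_compl G hY, neg _ fun j hj => ?_⟩
    exact 𝓔.not_both_sides hG hcut.1 i j hi ⟨hj.1.2, hj.2.2⟩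
  · push Not at hin
    exact ⟨Y, hY, rfl, neg _ fun i hi => hin i hi.1 hi.2⟩

open Classical in
theorem bdry_eq_four (hG : IsFinite G) (huv : ∀ e ∈ E(G), G.IsLink e (u e) (v e)) (A : Finset α)
    (hcut : IsCutOfType G σ 2 2 A) : bdry hG.2.toFinset u v A = 4 := by
  have hcutE : cut G A = (hG.2.toFinset.filter fun e => ¬ (u e ∈ A ↔ v e ∈ A) : Finset β) := by
    ext e
    simp only [Finset.coe_filter, Set.Finite.mem_toFinset]
    constructor
    · exact fun h => ⟨cut_subset_edgeSet G _ h,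
        by simpa using (mem_cut_iff huv (cut_subset_edgeSet G _ h) _).mp h⟩
    · exact fun h => (mem_cut_iff huv h.1 _).mpr (by simpa using h.2)
  have h1 : (cut G (A : Set α)).encard = 4 := by
    have hun : cut G (A : Set α) =
        cut G (A : Set α) ∩ posEdges G σ ∪ cut G (A : Set α) ∩ negEdges G σ := by
      rw [← Set.inter_union_distrib_left, eq_comm, Set.inter_eq_left]
      intro e he
      have := cut_subset_edgeSet G _ he
      exact (Int.units_eq_one_or (σ e)).imp (fun h => ⟨this, h⟩) fun h => ⟨this, h⟩
    rw [hun, Set.encard_union_eq, hcut.1, hcut.2]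
    · norm_num
    · rw [Set.disjoint_left]
      rintro e ⟨-, -, h⟩ ⟨-, -, h'⟩
      exact absurd (h.symm.trans h') (by decide)
  rw [hcutE, Set.encard_coe_eq_coe_finsetCard] at h1
  have h2 : (hG.2.toFinset.filter fun e => ¬ (u e ∈ A ↔ v e ∈ A)).card = 4 := by exact_mod_cast h1
  rw [Finset.card_filter, ← Nat.cast_inj (R := ℤ)] at h2
  push_cast at h2
  rw [bdry, ← h2]
  refine Finset.sum_congr rfl fun e _ => ?_
  unfold crossing
  by_cases h : u e ∈ A ↔ v e ∈ A <;> simp [h]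

open Classical in
theorem mem_inner_iff (hG : IsFinite G) (huv : ∀ e ∈ E(G), G.IsLink e (u e) (v e)) {A : Finset α}
    {e : β} : e ∈ inner hG.2.toFinset u v A ↔ e ∈ E(G.induce (A : Set α)) := by
  rw [Graph.edgeSet_induce]
  simp only [inner, Finset.mem_filter, Set.Finite.mem_toFinset]
  constructor
  · exact fun h => ⟨u e, v e, huv e h.1, h.2⟩
  · rintro ⟨x, y, h, hx, hy⟩
    refine ⟨h.edge_mem, ?_⟩
    rcases (huv e h.edge_mem).eq_and_eq_or_eq_and_eq h with ⟨h1, h2⟩ | ⟨h1, h2⟩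
    · rw [h1, h2]; exact ⟨hx, hy⟩
    · rw [h1, h2]; exact ⟨hy, hx⟩

theorem Joins.isLink (huv : ∀ e ∈ E(G), G.IsLink e (u e) (v e)) {e : β} (he : e ∈ E(G)) {a b : α}
    (h : Joins u v e a b) : G.IsLink e a b := by
  rcases h with ⟨rfl, rfl⟩ | ⟨rfl, rfl⟩
  · exact huv e he
  · exact (huv e he).symm

/-- The two negative edges of a cut leave its side `X` from different vertices. -/
theorem CanonicalEmbedding.exists_ends (𝓔 : CanonicalEmbedding G σ k) {X : Set α}
    (hcut : (cut G X ∩ negEdges G σ).encard = 2) :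
    ∃ a b c : Fin (2 * k), 𝓔.z a ∈ X ∧ 𝓔.z b ∈ X ∧ 𝓔.z a ≠ 𝓔.z b ∧ 𝓔.z c ∉ X := by
  obtain ⟨e, f, hef, hs⟩ := Set.encard_eq_two.mp hcut
  have ends : ∀ e ∈ cut G X ∩ negEdges G σ, ∃ i : Fin k, 𝓔.negEdge i = e ∧
      ∃ a c : Fin (2 * k), 𝓔.z a ∈ X ∧ 𝓔.z c ∉ X ∧ (a = fst i ∨ a = snd i) := by
    rintro e ⟨⟨x, y, h, hx, hy⟩, he⟩
    obtain ⟨i, rfl⟩ := 𝓔.mem_negEdges.mp he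
    refine ⟨i, rfl, ?_⟩
    rcases (𝓔.isLink_neg i).eq_and_eq_or_eq_and_eq h with ⟨rfl, rfl⟩ | ⟨rfl, rfl⟩
    · exact ⟨fst i, snd i, hx, hy.2, Or.inl rfl⟩
    · exact ⟨snd i, fst i, hx, hy.2, Or.inr rfl⟩
  obtain ⟨i, rfl, a, c, ha, hc, hai⟩ := ends e (hs ▸ by simp)
  obtain ⟨j, rfl, b, -, hb, -, hbj⟩ := ends f (hs ▸ by simp)
  refine ⟨a, b, c, ha, hb, fun h => ?_, hc⟩
  have hij : i ≠ j := fun h => hef (congrArg _ h)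
  have := 𝓔.z_injective h
  subst this
  rcases hai with rfl | rfl <;> rcases hbj with h | h
  · exact hij (fst_inj h)
  · exact fst_ne_snd _ _ h
  · exact fst_ne_snd _ _ h.symm
  · exact hij (snd_inj h)

open Classical in
theorem isCycle_induce (hG : IsFinite G) [G.Loopless] (huv : ∀ e ∈ E(G), G.IsLink e (u e) (v e))
    {A : Finset α}
    (hdeg : ∀ x ∈ A, ((inner hG.2.toFinset u v A).filter fun e => u e = x ∨ v e = x).card = 2)
    {x₀ x₁ x₂ x₃ : α} (hA : A = {x₀, x₁, x₂, x₃}) (h01 : (G.induce (A : Set α)).Adj x₀ x₁)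
    (h12 : (G.induce (A : Set α)).Adj x₁ x₂) (h30 : (G.induce (A : Set α)).Adj x₃ x₀) :
    IsCycle (G.induce (A : Set α)) := by
  have hreach : ∀ x ∈ A, Relation.ReflTransGen (G.induce (A : Set α)).Adj x₀ x ∧
      Relation.ReflTransGen (G.induce (A : Set α)).Adj x x₀ := by
    intro x hx
    rw [hA] at hx
    simp only [Finset.mem_insert, Finset.mem_singleton] at hx
    rcases hx with rfl | rfl | rfl | rfl
    · exact ⟨.refl, .refl⟩
    · exact ⟨.single h01, .single h01.symm⟩
    · exact ⟨.tail (.single h01) h12, .tail (.single h12.symm) h01.symm⟩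
    · exact ⟨.single h30.symm, .single h30⟩
  refine ⟨⟨⟨x₀, by simp [hA]⟩, fun x hx y hy => (hreach x hx).2.trans (hreach y hy).1⟩,
    fun x hx => ?_⟩
  have hl : (G.induce (A : Set α)).Loopless := ⟨fun e y h => Graph.not_isLoopAt G e y h.1⟩
  rw [degree_eq_ncard_incidenceSet, ← hdeg x hx, ← Set.ncard_coe_finset]
  congr 1
  ext e
  simp only [Graph.mem_incidenceSet, Finset.coe_filter, Set.mem_ofPred_eq,
    mem_inner_iff hG huv]
  constructor
  · rintro ⟨y, hy⟩
    refine ⟨hy.edge_mem, ?_⟩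
    rcases (huv e hy.1.edge_mem).eq_and_eq_or_eq_and_eq hy.1 with h | h
    · exact Or.inl h.1
    · exact Or.inr h.2
  · rintro ⟨⟨a, b, h⟩, hx'⟩
    rcases (huv e h.1.edge_mem).eq_and_eq_or_eq_and_eq h.1 with ⟨rfl, rfl⟩ | ⟨rfl, rfl⟩ <;>
      rcases hx' with rfl | rfl
    exacts [⟨_, h⟩, ⟨_, Graph.IsLink.symm h⟩, ⟨_, Graph.IsLink.symm h⟩, ⟨_, h⟩]

open Classical in
/-- Every `(2, 2)`-cut of a critical signed graph with a canonical embedding has a side that induces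
`K₂` or a facial 4-cycle. -/
theorem CanonicalEmbedding.exists_side_of_cut (𝓔 : CanonicalEmbedding G σ k) (hG : IsFinite G)
    (hcrit : IsCritical G σ k) {Y : Set α} (hY : Y ⊆ V(G)) (hcut : IsCutOfType G σ 2 2 Y) :
    ∃ X ⊆ V(G), cut G X = cut G Y ∧ (IsK2 (G.induce X) ∨ 𝓔.IsFourFace (G.induce X)) := by
  have hl := 𝓔.loopless
  obtain ⟨X, hX, hXY, hpos⟩ := 𝓔.exists_positive_side hG hY hcut
  refine ⟨X, hX, hXY, ?_⟩
  rw [IsCutOfType, ← hXY] at hcut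
  obtain ⟨A, rfl⟩ := (hG.1.subset hX).exists_finset_coe
  have hends : ∃ u v : β → α, ∀ e ∈ E(G), G.IsLink e (u e) (v e) := by
    have h0 : α := 𝓔.outer.tail
    have : ∀ e, ∃ x y, e ∈ E(G) → G.IsLink e x y := fun e => by
      by_cases he : e ∈ E(G)
      · obtain ⟨x, y, h⟩ := Graph.exists_isLink_of_mem_edgeSet he
        exact ⟨x, y, fun _ => h⟩
      · exact ⟨h0, h0, fun h => absurd h he⟩
    choose u v h using this
    exact ⟨u, v, h⟩
  obtain ⟨u, v, huv⟩ := hends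
  have hC := 𝓔.cubicCritical hG hcrit huv
  have hAV : A ⊆ hG.1.toFinset := fun x hx => (Set.Finite.mem_toFinset _).mpr (hX hx)
  have hin : ∀ e, e ∈ inner hG.2.toFinset u v A ↔ e ∈ E(G.induce (A : Set α)) :=
    fun e => mem_inner_iff hG huv
  have hpos' : ∀ e ∈ inner hG.2.toFinset u v A, ((σ e : ℤˣ) : ℤ) = 1 := by
    intro e he
    obtain ⟨x, y, h, hx, hy⟩ := (hin e).mp he
    rw [hpos e x y h hx hy]
    rfl
  have hd := bdry_eq_four hG huv A hcut
  have hle := hC.card_le_four hAV hpos' hd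
  have hcard := hC.three_mul_card hAV
  obtain ⟨a, b, c, ha, hb, hab, hc⟩ := 𝓔.exists_ends hcut.2
  -- The degree count with four boundary edges makes |A| even and nonzero.
  obtain h2 | h4 : A.card = 2 ∨ A.card = 4 := by omega
  · left
    obtain ⟨e, he⟩ := Finset.card_eq_one.mp
      (show (inner hG.2.toFinset u v A).card = 1 by omega)
    have hmem : e ∈ inner hG.2.toFinset u v A := he ▸ Finset.mem_singleton_self e
    have hne := hC.ne_of_mem_inner hAV hpos' hmem
    have hmem' := hmem
    simp only [inner, Finset.mem_filter, Set.Finite.mem_toFinset] at hmem'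
    refine ⟨u e, v e, e, hne, ?_, ?_, huv e hmem'.1, hmem'.2⟩
    · have : ({u e, v e} : Finset α) = A := by
        apply Finset.eq_of_subset_of_card_le
        · intro t
          simp only [Finset.mem_insert, Finset.mem_singleton]
          rintro (rfl | rfl)
          exacts [hmem'.2.1, hmem'.2.2]
        · rw [h2, Finset.card_pair hne]
      rw [Graph.vertexSet_induce, ← this]
      simp
    · ext f
      rw [← hin, he]
      simp
  · right
    obtain ⟨y₁, y₂, w, e₁, e₂, e₃, e₄, hA, ⟨n1, n2, n3, n4, n5, n6⟩, j₁, j₂, j₃, j₄, hE⟩ :=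
      hC.exists_square hAV hpos' hd h4 (Finset.mem_coe.mp ha)
    have rot : ∀ p q r s : Prop, (p ∨ q ∨ r ∨ s) ↔ (q ∨ r ∨ s ∨ p) := by
      intros; tauto
    have hlink : ∀ {e x y}, (e = e₁ ∨ e = e₂ ∨ e = e₃ ∨ e = e₄) → Joins u v e x y →
        (posSubgraph G σ).IsLink e x y := by
      intro e x y he hj
      obtain ⟨p, q, h, hp, hq⟩ := (hin e).mp ((hE e).mpr he)
      exact isLink_posSubgraph.mpr ⟨hj.isLink huv h.edge_mem, hpos e p q h hp hq⟩
    have l₁ := hlink (by simp) j₁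
    have l₂ := hlink (by simp) j₂
    have l₃ := hlink (by simp) j₃
    have l₄ := hlink (by simp) j₄
    have hmA : ∀ t, t ∈ A ↔ t = 𝓔.z a ∨ t = y₁ ∨ t = w ∨ t = y₂ := by
      intro t; rw [hA]; simp
    -- The square starts with e₄ so that `𝓔.z a`, of degree two in G⁺, is the tail of its second
    -- dart. The vertex `𝓔.z b` is the other one of degree two, and `𝓔.z c` is a vertex of the outer
    -- face off the square.
    have hsq : IsSquare (G := posSubgraph G σ) ⟨e₄, _, _, l₄⟩ ⟨e₁, _, _, l₁⟩ ⟨e₂, _, _, l₂⟩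
        ⟨e₃, _, _, l₃⟩ :=
      ⟨rfl, rfl, rfl, rfl, n3.symm, n5.symm, n6.symm, n1, n2, n4⟩
    obtain ⟨d, hd1, hd2⟩ := 𝓔.exists_outer b
    obtain ⟨g, hg1, hg2⟩ := 𝓔.exists_outer c
    have hb' := (hmA _).mp hb
    have hc' := (not_congr (hmA (𝓔.z c))).mp hc
    obtain ⟨r, r1, r2, r3, r4⟩ := PlaneEmbedding.boundsFace_of_square hG.posSubgraph 𝓔.twoConnected
      hsq (fun x hx => 𝓔.degree_posSubgraph hx) (𝓔.degree_z a) (𝓔.exists_outer a)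
      ⟨d, hd1, hd2 ▸ 𝓔.degree_z b, by
        rw [hd2]
        have := hab.symm
        tauto⟩
      ⟨g, hg1, by rw [hg2]; tauto⟩
    have adj : ∀ {e x y}, (posSubgraph G σ).IsLink e x y → x ∈ A → y ∈ A →
        (G.induce (A : Set α)).Adj x y := fun h hx hy =>
      ⟨_, (isLink_posSubgraph.mp h).1, hx, hy⟩
    refine ⟨isCycle_induce hG huv (fun x hx => hC.card_inner_at hAV hpos' hd h4 hx) hA
      (adj l₁ ?_ ?_) (adj l₂ ?_ ?_) (adj l₄ ?_ ?_), ?_, r, r1, r2, r3.trans ?_, r4.trans ?_⟩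
    any_goals (rw [hmA]; simp)
    · rw [Graph.vertexSet_induce, Set.ncard_coe_finset, h4]
    · ext t
      rw [Graph.vertexSet_induce, Finset.mem_coe, hmA]
      simp only [Set.mem_insert_iff, Set.mem_singleton_iff]
      exact rot _ _ _ _
    · ext t
      rw [← hin, hE]
      simp only [Set.mem_insert_iff, Set.mem_singleton_iff]
      exact rot _ _ _ _

end Canonical
end SignedGraph

theorem corollary2p7 {α : Type*} {β : Type*} (G : Graph α β) (hG : SignedGraph.IsFinite G)
    (σ : β → ℤˣ) (k : ℕ) (hk : 2 ≤ k) (hprime : SignedGraph.IsPrimeCritical G σ k)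
    (𝓔 : SignedGraph.CanonicalEmbedding G σ k)
    (Y : Set α) (hY : Y ⊆ V(G)) (hcut : SignedGraph.IsCutOfType G σ 2 2 Y) :
    ∃ X ⊆ V(G), SignedGraph.cut G X = SignedGraph.cut G Y ∧
      (SignedGraph.IsK2 (G.induce X) ∨ 𝓔.IsFourFace (G.induce X)) := by
  exact 𝓔.exists_side_of_cut hG hprime.1 hY hcut
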